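/- **Conventions.** Let $\mathbb H$ be the upper half plane, $\Gamma(M)\subseteq SL_2(\mathbb Z)$ ($M\ge 1$) the principal congruence subgroups, $q=e^{2\pi i z}$, and $(f|_k\gamma)(z)=(cz+d)^{-k}f(\gamma z)$ for $\gamma=\begin{pmatrix}a&b\\c&d\end{pmatrix}\in SL_2(\mathbb Z)$. Vector spaces, Lie algebras and tensor products are over $\mathbb C$. *Quasimodular tower.* Let $\mathcal M_k$ be the space of all modular forms of weight $k\in\mathbb Z$ and any level $\Gamma(M)$, $M\ge1$. A holomorphic $f:\mathbb H\to\mathbb C$ is quasimodular of level $\Gamma(M)$, weight $k$ and depth $s$ if there are functions $f_0,\dots,f_s$ on $\mathbb H$, $f_s\neq0$, with $f_j$ holomorphic on $\mathbb H$ and at the cusps (that is, $f_j|_{k-2j}\delta$ is bounded as $\operatorname{Im}z\to\infty$ for every $\delta\in SL_2(\mathbb Z)$), such that $(f|_k\gamma)(z)=\sum_{j=0}^s f_j(z)\left(\frac{c}{cz+d}\right)^j$ for all $\gamma=\begin{pmatrix}a&b\\c&d\end{pmatrix}\in\Gamma(M)$ and $z\in\mathbb H$. Let $\mathcal{QM}_k$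 be the space consisting of $0$ and all quasimodular forms of weight $k$, any depth and any level, and let $\mathcal{QM}=\bigoplus_{k\ge0}\mathcal{QM}_k$, a commutative graded algebra. With $G_2=-\frac1{24}+\sum_{n\ge1}\left(\sum_{d\mid n}d\right)q^n$, each $f\in\mathcal{QM}_k$ is uniquely a finite sum $f=\sum_{i\ge0}a_i(f)G_2^i$ with $a_i(f)\in\mathcal M_{k-2i}$. For $\gamma\in SL_2(\mathbb Z)$ and $f\in\mathcal{QM}_k$ put $$f\|\gamma=\sum_i \big(a_i(f)|_{k-2i}\gamma\big)G_2^i,\qquad X(f)=\sum_i X(a_i(f))G_2^i,\qquad Y(f)=\sum_i Y(a_i(f))G_2^i,$$ where for $g\in\mathcal M_w$ we set $Y(g)=\frac w2g$ and $X(g)=\frac1{2\pi i}\frac{dg}{dz}-\frac1{12\pi i}\frac{d\log\Delta}{dz}\,Y(g)$, with $\Delta=(2\pi)^{12}q\prod_{n\ge1}(1-q^n)^{24}$; extend these operations linearly to $\mathcal{QM}$. *Twisted Hecke operators.* Let $\Gamma=\Gamma(N)$ with $N\ge1$, and let $\sigma\in SL_2(\mathbb Z)$. For $\sigma'\in SL_2(\mathbb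 Z)$ let $\mathcal Q_{\sigma'}(\Gamma)$ be the space of functions $F:\Gamma\backslash GL_2^+(\mathbb Q)\to\mathcal{QM}$, $\Gamma\alpha\mapsto F_\alpha$, of finite support such that $F_{\alpha\gamma}=F_\alpha\|\sigma'\gamma\sigma'^{-1}$ for all $\alpha\in GL_2^+(\mathbb Q)$, $\gamma\in\Gamma$. For $m\in\mathbb Z$ let $\rho_m=\begin{pmatrix}1&m\\0&1\end{pmatrix}$ and $\sigma(m)=\rho_m\sigma$, and let $\mathbb Q_\sigma(\Gamma)=\bigoplus_{m\in\mathbb Z}\mathcal Q_{\sigma(m)}(\Gamma)$. Define on $\mathbb Q_\sigma(\Gamma)$, for $F\in\mathcal Q_{\sigma(m)}(\Gamma)$ and $n\in\mathbb Z$, the operators $$X_n(F)_\alpha=X(F_\alpha)\|\rho_n^{-1},\quad X_n(F)\in\mathcal Q_{\sigma(m+n)}(\Gamma);\qquad Z(F)_\alpha=mF_\alpha+Y(F_\alpha),\quad Z(F)\in\mathcal Q_{\sigma(m)}(\Gamma),$$ and the bilinear pairing $(\ ,\ )$ on $\mathbb Q_\sigma(\Gamma)$ given, for $F^1\in\mathcal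 Q_{\sigma(m)}(\Gamma)$ and $F^2\in\mathcal Q_{\sigma(n)}(\Gamma)$, by the element $(F^1,F^2)\in\mathcal Q_{\sigma(m+n)}(\Gamma)$ with $$(F^1,F^2)_\alpha=\sum_{\beta\in\Gamma\backslash SL_2(\mathbb Z)}\big(F^1_{\beta\sigma}\|\rho_n^{-1}\big)\cdot\big(F^2_{\alpha\sigma^{-1}\beta^{-1}}\|\rho_n\sigma\beta\rho_m^{-1}\rho_n^{-1}\big).$$ *The Hopf algebra.* Let $\mathfrak l_{\mathbb Z}$ be the Lie algebra with generators $Z$, $X_n$ ($n\in\mathbb Z$) and relations $[Z,X_n]=(n+1)X_n$ and $[X_n,X_{n'}]=0$ ($n,n'\in\mathbb Z$). Let $\mathfrak h_{\mathbb Z}$ be its universal enveloping algebra, with its usual Hopf algebra structure, so that its coproduct $\Delta_{\mathfrak h}$ satisfies $\Delta_{\mathfrak h}(x)=x\otimes1+1\otimes x$ for $x\in\mathfrak l_{\mathbb Z}$; write $\Delta_{\mathfrak h}(h)=\sum h_{(1)}\otimes h_{(2)}$. **Theorem.** For every $N\ge 1$ and $\sigma\in SL_2(\mathbb Z)$, with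 $\Gamma=\Gamma(N)$, there is an action of the algebra $\mathfrak h_{\mathbb Z}$ on $\mathbb Q_\sigma(\Gamma)$ in which the generators $X_n$ and $Z$ act as the operators $X_n$ and $Z$ above, and it is a Hopf action on the pairing: $$h(F^1,F^2)=\sum\big(h_{(1)}(F^1),h_{(2)}(F^2)\big)\qquad\text{for all }h\in\mathfrak h_{\mathbb Z},\ F^1,F^2\in\mathbb Q_\sigma(\Gamma).$$ In particular $X_n(F^1,F^2)=(X_n(F^1),F^2)+(F^1,X_n(F^2))$ for all $n\in\mathbb Z$, and $Z(F^1,F^2)=(Z(F^1),F^2)+(F^1,Z(F^2))$. -/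

import Mathlib

open scoped UpperHalfPlane MatrixGroups ModularForm Manifold DirectSum TensorProduct Polynomial

noncomputable section

namespace QuasiHecke

open UpperHalfPlane (IsBoundedAtImInfty)

/-! ### The modular tower -/

/-- `f` is a modular form of weight `w` for the principal congruence subgroup `Γ(N)`. -/
def IsModular (N : ℕ) (w : ℤ) (f : ℍ → ℂ) : Prop :=
  ∃ g : ModularForm (CongruenceSubgroup.Gamma N : Subgroup (GL (Fin 2) ℝ)) w, ⇑g = f

/-- `f` is holomorphic and, for the weight `w` slash action, bounded at every cusp. -/
def HoloBdd (w : ℤ) (f : ℍ → ℂ) : Prop :=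
  MDiff f ∧ ∀ δ : SL(2, ℤ), IsBoundedAtImInfty (f ∣[w] δ)

lemma isModular_iff {N : ℕ} [NeZero N] {w : ℤ} {f : ℍ → ℂ} :
    IsModular N w f ↔
      HoloBdd w f ∧ ∀ γ ∈ CongruenceSubgroup.Gamma N, f ∣[w] γ = f := by
  constructor
  · rintro ⟨g, rfl⟩
    refine ⟨⟨g.holo', fun δ => ?_⟩, fun γ hγ => ?_⟩
    · have hc : IsCusp ((Matrix.SpecialLinearGroup.mapGL ℝ δ) • OnePoint.infty)
          (CongruenceSubgroup.Gamma N : Subgroup (GL (Fin 2) ℝ)) := by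
        rw [Subgroup.IsArithmetic.isCusp_iff_isCusp_SL2Z, isCusp_SL2Z_iff']
        exact ⟨δ, rfl⟩
      exact g.bdd_at_cusps' hc _ rfl
    · exact g.slash_action_eq' _ ⟨γ, hγ, rfl⟩
  · rintro ⟨⟨h1, h2⟩, h3⟩
    refine ⟨⟨⟨f, ?_⟩, h1, ?_⟩, rfl⟩
    · rintro _ ⟨γ, hγ, rfl⟩
      exact h3 γ hγ
    · intro c hc
      rw [Subgroup.IsArithmetic.isCusp_iff_isCusp_SL2Z] at hc
      rw [OnePoint.isBoundedAt_iff_forall_SL2Z hc]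
      exact fun γ _ => h2 γ

lemma HoloBdd.zero (w : ℤ) : HoloBdd w 0 :=
  ⟨mdifferentiable_const, fun δ => by
    simpa using UpperHalfPlane.zero_form_isBoundedAtImInfty⟩

lemma HoloBdd.add {w : ℤ} {f g : ℍ → ℂ} (hf : HoloBdd w f) (hg : HoloBdd w g) :
    HoloBdd w (f + g) :=
  ⟨hf.1.add hg.1, fun δ => by
    rw [SlashAction.add_slash]; exact (hf.2 δ).add (hg.2 δ)⟩

lemma HoloBdd.smul {w : ℤ} {f : ℍ → ℂ} (c : ℂ) (hf : HoloBdd w f) :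
    HoloBdd w (c • f) :=
  ⟨hf.1.const_smul c, fun δ => by
    rw [ModularForm.SL_smul_slash]; exact (hf.2 δ).const_smul_left c⟩

lemma HoloBdd.mul {v w : ℤ} {f g : ℍ → ℂ} (hf : HoloBdd v f) (hg : HoloBdd w g) :
    HoloBdd (v + w) (f * g) :=
  ⟨hf.1.mul hg.1, fun δ => by
    rw [ModularForm.mul_slash_SL2]; exact (Filter.BoundedAtFilter.mul (hf.2 δ) (hg.2 δ))⟩

lemma HoloBdd.sum {ι : Type*} {w : ℤ} (s : Finset ι) (f : ι → ℍ → ℂ)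
    (h : ∀ i ∈ s, HoloBdd w (f i)) : HoloBdd w (∑ i ∈ s, f i) :=
  Finset.sum_induction f (HoloBdd w) (fun _ _ => HoloBdd.add) (HoloBdd.zero w) h

lemma HoloBdd.one : HoloBdd 0 1 :=
  ⟨mdifferentiable_const, fun δ => by
    rw [ModularForm.is_invariant_one]
    exact Filter.const_boundedAtFilter _ (1 : ℂ)⟩

lemma HoloBdd.slash {w : ℤ} {f : ℍ → ℂ} (hf : HoloBdd w f) (γ : SL(2, ℤ)) :
    HoloBdd w (f ∣[w] γ) :=
  ⟨hf.1.slash w _, fun δ => by rw [← SlashAction.slash_mul]; exact hf.2 _⟩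

lemma Gamma_le_of_dvd {N M : ℕ} (h : N ∣ M) :
    CongruenceSubgroup.Gamma M ≤ CongruenceSubgroup.Gamma N := by
  intro γ hγ
  rw [CongruenceSubgroup.Gamma_mem] at hγ ⊢
  have key : ∀ a b : ℤ, (a : ZMod M) = b → (a : ZMod N) = b := by
    intro a b hab
    rw [ZMod.intCast_eq_intCast_iff_dvd_sub] at hab ⊢
    exact dvd_trans (by exact_mod_cast h) hab
  have k1 := key _ 1 (by simpa using hγ.1)
  have k2 := key _ 0 (by simpa using hγ.2.1)
  have k3 := key _ 0 (by simpa using hγ.2.2.1)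
  have k4 := key _ 1 (by simpa using hγ.2.2.2)
  exact ⟨by simpa using k1, by simpa using k2, by simpa using k3, by simpa using k4⟩

lemma IsModular.level_mono {N M : ℕ} [NeZero N] [NeZero M] (h : N ∣ M) {w : ℤ} {f : ℍ → ℂ}
    (hf : IsModular N w f) : IsModular M w f := by
  rw [isModular_iff] at hf ⊢
  exact ⟨hf.1, fun γ hγ => hf.2 γ (Gamma_le_of_dvd h hγ)⟩

/-- The weight `w` part of the modular tower: modular forms of weight `w` and any level
`Γ(N)`, `N ≥ 1`. -/
def modTower (w : ℤ) : Submodule ℂ (ℍ → ℂ) where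
  carrier := {f | ∃ N : ℕ, N ≠ 0 ∧ IsModular N w f}
  zero_mem' := ⟨1, one_ne_zero, isModular_iff.2 ⟨HoloBdd.zero w, fun _ _ => by simp⟩⟩
  add_mem' := by
    rintro f g ⟨N, hN, hf⟩ ⟨M, hM, hg⟩
    have : NeZero N := ⟨hN⟩
    have : NeZero M := ⟨hM⟩
    have hf := isModular_iff.1 (hf.level_mono (Dvd.intro M rfl : N ∣ N * M))
    have hg := isModular_iff.1 (hg.level_mono (Dvd.intro_left N rfl : M ∣ N * M))
    refine ⟨N * M, mul_ne_zero hN hM, isModular_iff.2 ⟨hf.1.add hg.1, fun γ hγ => ?_⟩⟩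
    rw [SlashAction.add_slash, hf.2 γ hγ, hg.2 γ hγ]
  smul_mem' := by
    rintro c f ⟨N, hN, hf⟩
    have : NeZero N := ⟨hN⟩
    have hf := isModular_iff.1 hf
    refine ⟨N, hN, isModular_iff.2 ⟨hf.1.smul c, fun γ hγ => ?_⟩⟩
    rw [ModularForm.SL_smul_slash, hf.2 γ hγ]

lemma mem_modTower {w : ℤ} {f : ℍ → ℂ} : f ∈ modTower w ↔ ∃ N : ℕ, N ≠ 0 ∧ IsModular N w f :=
  Iff.rfl

lemma modTower_mul {v w : ℤ} {f g : ℍ → ℂ} (hf : f ∈ modTower v) (hg : g ∈ modTower w) :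
    f * g ∈ modTower (v + w) := by
  obtain ⟨N, hN, hf⟩ := hf
  obtain ⟨M, hM, hg⟩ := hg
  have : NeZero N := ⟨hN⟩
  have : NeZero M := ⟨hM⟩
  have hf := isModular_iff.1 (hf.level_mono (Dvd.intro M rfl : N ∣ N * M))
  have hg := isModular_iff.1 (hg.level_mono (Dvd.intro_left N rfl : M ∣ N * M))
  refine ⟨N * M, mul_ne_zero hN hM, isModular_iff.2 ⟨hf.1.mul hg.1, fun γ hγ => ?_⟩⟩
  rw [ModularForm.mul_slash_SL2, hf.2 γ hγ, hg.2 γ hγ]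

lemma modTower_slash {w : ℤ} {f : ℍ → ℂ} (hf : f ∈ modTower w) (δ : SL(2, ℤ)) :
    f ∣[w] δ ∈ modTower w := by
  obtain ⟨N, hN, hf⟩ := hf
  have : NeZero N := ⟨hN⟩
  have hf := isModular_iff.1 hf
  refine ⟨N, hN, isModular_iff.2 ⟨hf.1.slash δ, fun γ hγ => ?_⟩⟩
  have h := hf.2 (δ * γ * δ⁻¹) ((CongruenceSubgroup.Gamma_normal N).conj_mem γ hγ δ)
  calc (f ∣[w] δ) ∣[w] γ = f ∣[w] (δ * γ * δ⁻¹ * δ) := by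
        rw [← SlashAction.slash_mul]; congr 1; group
    _ = f ∣[w] δ := by rw [SlashAction.slash_mul, h]

/-! ### Quasimodular forms -/

/-- The quantity `c / (c z + d)` attached to `γ = (a, b; c, d)`. -/
def cRatio (γ : SL(2, ℤ)) (z : ℍ) : ℂ :=
  ((γ 1 0 : ℤ) : ℂ) / (((γ 1 0 : ℤ) : ℂ) * z + ((γ 1 1 : ℤ) : ℂ))

/-- `f` is a quasimodular form of level `Γ(N)`, weight `k` and depth exactly `s`. As for
modular forms, the component functions `F j`, which have weight `k - 2 j`, are required to be
holomorphic on `ℍ` and at the cusps. -/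
def IsQuasimodular (N : ℕ) (k : ℤ) (s : ℕ) (f : ℍ → ℂ) : Prop :=
  MDiff f ∧ ∃ F : Fin (s + 1) → ℍ → ℂ,
    (∀ j, MDiff (F j)) ∧
    (∀ (j : Fin (s + 1)) (δ : SL(2, ℤ)),
      IsBoundedAtImInfty (F j ∣[k - 2 * ((j : ℕ) : ℤ)] δ)) ∧
    F (Fin.last s) ≠ 0 ∧
    ∀ γ ∈ CongruenceSubgroup.Gamma N, ∀ z : ℍ,
      (f ∣[k] γ) z = ∑ j : Fin (s + 1), F j z * cRatio γ z ^ (j : ℕ)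

/-- Auxiliary: the component functions organised as a polynomial. -/
def HasPoly (N : ℕ) (k : ℤ) (p : (ℍ → ℂ)[X]) (f : ℍ → ℂ) : Prop :=
  (∀ j : ℕ, HoloBdd (k - 2 * (j : ℤ)) (p.coeff j)) ∧
    ∀ γ ∈ CongruenceSubgroup.Gamma N, ∀ z : ℍ,
      (f ∣[k] γ) z = p.eval₂ (Pi.evalRingHom (fun _ : ℍ => ℂ) z) (cRatio γ z)

lemma HasPoly.add {N : ℕ} {k : ℤ} {p q : (ℍ → ℂ)[X]} {f g : ℍ → ℂ}
    (hf : HasPoly N k p f) (hg : HasPoly N k q g) : HasPoly N k (p + q) (f + g) :=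
  ⟨fun j => by rw [Polynomial.coeff_add]; exact (hf.1 j).add (hg.1 j), fun γ hγ z => by
    rw [SlashAction.add_slash, Pi.add_apply, hf.2 γ hγ, hg.2 γ hγ, Polynomial.eval₂_add]⟩

lemma HasPoly.smul {N : ℕ} {k : ℤ} {p : (ℍ → ℂ)[X]} {f : ℍ → ℂ} (c : ℂ)
    (hf : HasPoly N k p f) : HasPoly N k (c • p) (c • f) :=
  ⟨fun j => by rw [Polynomial.coeff_smul]; exact (hf.1 j).smul c, fun γ hγ z => by
    rw [ModularForm.SL_smul_slash, Pi.smul_apply, hf.2 γ hγ, Polynomial.eval₂_eq_sum_range' _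
      (Nat.lt_succ_iff.2 (Polynomial.natDegree_smul_le c p)),
      Polynomial.eval₂_eq_sum_range, smul_eq_mul, Finset.mul_sum]
    exact Finset.sum_congr rfl fun i _ => by simp [mul_assoc]⟩

lemma HasPoly.mul {N : ℕ} {k l : ℤ} {p q : (ℍ → ℂ)[X]} {f g : ℍ → ℂ}
    (hf : HasPoly N k p f) (hg : HasPoly N l q g) : HasPoly N (k + l) (p * q) (f * g) :=
  ⟨fun j => by
    rw [Polynomial.coeff_mul]
    refine HoloBdd.sum _ _ fun x hx => ?_
    have := (hf.1 x.1).mul (hg.1 x.2)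
    rw [Finset.HasAntidiagonal.mem_antidiagonal] at hx
    rwa [show k - 2 * (x.1 : ℤ) + (l - 2 * (x.2 : ℤ)) = k + l - 2 * (j : ℤ) by
      rw [← hx]; push_cast; ring] at this,
   fun γ hγ z => by
    rw [ModularForm.mul_slash_SL2, Pi.mul_apply, hf.2 γ hγ, hg.2 γ hγ, Polynomial.eval₂_mul]⟩

lemma HasPoly.level_mono {N M : ℕ} (h : N ∣ M) {k : ℤ} {p : (ℍ → ℂ)[X]} {f : ℍ → ℂ}
    (hf : HasPoly N k p f) : HasPoly M k p f :=
  ⟨hf.1, fun γ hγ z => hf.2 γ (Gamma_le_of_dvd h hγ) z⟩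

lemma HasPoly.eq_coeff_zero {N : ℕ} {k : ℤ} {p : (ℍ → ℂ)[X]} {f : ℍ → ℂ}
    (hf : HasPoly N k p f) : f = p.coeff 0 := by
  ext z
  have := hf.2 1 (one_mem _) z
  rw [SlashAction.slash_one] at this
  rw [this]
  simp [cRatio, Polynomial.eval₂_at_zero]

lemma hasPoly_of_isModular {N : ℕ} [NeZero N] {k : ℤ} {f : ℍ → ℂ} (hf : IsModular N k f) :
    HasPoly N k (Polynomial.C f) f := by
  rw [isModular_iff] at hf
  refine ⟨fun j => ?_, fun γ hγ z => by simp [hf.2 γ hγ]⟩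
  rw [Polynomial.coeff_C]
  split_ifs with h
  · simpa [h] using hf.1
  · exact HoloBdd.zero _

lemma hasPoly_iff {N : ℕ} {k : ℤ} {f : ℍ → ℂ} :
    (∃ p, HasPoly N k p f) ↔ (f = 0 ∨ ∃ s, IsQuasimodular N k s f) := by
  constructor
  · rintro ⟨p, hp⟩
    by_cases h0 : p = 0
    · left; rw [hp.eq_coeff_zero, h0]; simp
    · right
      refine ⟨p.natDegree, hp.eq_coeff_zero ▸ (hp.1 0).1, fun j => p.coeff j,
        fun j => (hp.1 j).1, fun j => (hp.1 j).2, ?_, fun γ hγ z => ?_⟩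
      · simpa using h0
      · rw [hp.2 γ hγ z, Polynomial.eval₂_eq_sum_range, Finset.sum_range]
        rfl
  · rintro (rfl | ⟨s, _, F, h1, h2, _, h4⟩)
    · exact ⟨0, fun j => by simpa using HoloBdd.zero _, fun γ _ z => by simp⟩
    · refine ⟨∑ j : Fin (s + 1), Polynomial.monomial (j : ℕ) (F j), fun j => ?_,
        fun γ hγ z => ?_⟩
      · rw [Polynomial.finsetSum_coeff]
        refine HoloBdd.sum _ _ fun i _ => ?_
        rw [Polynomial.coeff_monomial]
        split_ifs with h
        · subst h; exact ⟨h1 i, h2 i⟩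
        · exact HoloBdd.zero _
      · rw [h4 γ hγ z, Polynomial.eval₂_finsetSum]
        simp [Polynomial.eval₂_monomial]

lemma hasPoly_iff_exists {k : ℤ} {f : ℍ → ℂ} :
    (f = 0 ∨ ∃ N s : ℕ, N ≠ 0 ∧ IsQuasimodular N k s f) ↔
      ∃ N : ℕ, N ≠ 0 ∧ ∃ p, HasPoly N k p f := by
  simp only [hasPoly_iff]
  exact ⟨fun h => h.elim (fun h => ⟨1, one_ne_zero, Or.inl h⟩)
    fun ⟨N, s, hN, h⟩ => ⟨N, hN, Or.inr ⟨s, h⟩⟩,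
    fun ⟨N, hN, h⟩ => h.imp id fun ⟨s, h⟩ => ⟨N, s, hN, h⟩⟩

/-- The weight `k` part of the quasimodular tower: quasimodular forms of weight `k`, of any depth
and any level `Γ(N)`, `N ≥ 1`, together with the zero function. -/
def quasiTower (k : ℤ) : Submodule ℂ (ℍ → ℂ) where
  carrier := {f | f = 0 ∨ ∃ N s : ℕ, N ≠ 0 ∧ IsQuasimodular N k s f}
  zero_mem' := Or.inl rfl
  add_mem' := by
    intro f g hf hg
    obtain ⟨N, hN, p, hf⟩ := hasPoly_iff_exists.1 hf
    obtain ⟨M, hM, q, hg⟩ := hasPoly_iff_exists.1 hg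
    exact hasPoly_iff_exists.2 ⟨N * M, mul_ne_zero hN hM, p + q,
      (hf.level_mono (Dvd.intro M rfl)).add (hg.level_mono (Dvd.intro_left N rfl))⟩
  smul_mem' := by
    intro c f hf
    obtain ⟨N, hN, p, hf⟩ := hasPoly_iff_exists.1 hf
    exact hasPoly_iff_exists.2 ⟨N, hN, c • p, hf.smul c⟩

lemma mem_quasiTower {k : ℤ} {f : ℍ → ℂ} :
    f ∈ quasiTower k ↔ ∃ N : ℕ, N ≠ 0 ∧ ∃ p, HasPoly N k p f :=
  hasPoly_iff_exists

lemma quasiTower_mul {k l : ℤ} {f g : ℍ → ℂ} (hf : f ∈ quasiTower k) (hg : g ∈ quasiTower l) :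
    f * g ∈ quasiTower (k + l) := by
  obtain ⟨N, hN, p, hf⟩ := mem_quasiTower.1 hf
  obtain ⟨M, hM, q, hg⟩ := mem_quasiTower.1 hg
  exact mem_quasiTower.2 ⟨N * M, mul_ne_zero hN hM, p * q,
    (hf.level_mono (Dvd.intro M rfl)).mul (hg.level_mono (Dvd.intro_left N rfl))⟩

lemma modTower_le_quasiTower (k : ℤ) : modTower k ≤ quasiTower k := by
  rintro f ⟨N, hN, hf⟩
  have : NeZero N := ⟨hN⟩
  exact mem_quasiTower.2 ⟨N, hN, _, hasPoly_of_isModular hf⟩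

/-! ### The Eisenstein series of weight two and the structure of quasimodular forms -/

/-- The Eisenstein series `G₂ = -B₂/4 + ∑ σ₁(n) qⁿ`, with `B₂ = 1/6` and `q = exp (2πiz)`. -/
def eisG2 (z : ℍ) : ℂ :=
  -(bernoulli 2 : ℂ) / (2 * 2) + ∑' n : ℕ+, ((ArithmeticFunction.sigma 1 (n : ℕ) : ℕ) : ℂ) *
    Complex.exp (2 * Real.pi * Complex.I * (n : ℕ) * z)

lemma eisG2_eq : eisG2 = (-(1 / 24) : ℂ) • EisensteinSeries.E2 := by
  ext z
  simp only [eisG2, Pi.smul_apply, smul_eq_mul, EisensteinSeries.E2_eq_tsum_cexp, bernoulli_two]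
  have : ∀ n : ℕ+, Complex.exp (2 * Real.pi * Complex.I * (n : ℕ) * z) =
      Complex.exp (2 * Real.pi * Complex.I * z) ^ (n : ℕ) := by
    intro n; rw [← Complex.exp_nat_mul]; congr 1; ring
  simp only [this]
  push_cast
  ring

lemma denom_eq (γ : SL(2, ℤ)) (z : ℍ) : UpperHalfPlane.denom (γ : GL (Fin 2) ℝ) z =
    ((γ 1 0 : ℤ) : ℂ) * z + ((γ 1 1 : ℤ) : ℂ) := ModularGroup.denom_apply γ z

lemma cRatio_eq (γ : SL(2, ℤ)) (z : ℍ) :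
    EisensteinSeries.D2 γ z = 2 * Real.pi * Complex.I * cRatio γ z := by
  simp only [EisensteinSeries.D2, cRatio, denom_eq]
  ring

/-- The constant in the transformation law of `G₂`. -/
def cG2 : ℂ := (1 / 24) * (1 / (2 * riemannZeta 2)) * (2 * Real.pi * Complex.I)

lemma cG2_ne : cG2 ≠ 0 := by
  simp [cG2, riemannZeta_two, Real.pi_ne_zero]

lemma eisG2_slash (γ : SL(2, ℤ)) : eisG2 ∣[(2 : ℤ)] γ = eisG2 + cG2 • cRatio γ := by
  rw [eisG2_eq, ModularForm.SL_smul_slash, EisensteinSeries.E2_slash_action]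
  ext z
  simp only [Pi.smul_apply, Pi.sub_apply, Pi.add_apply, cRatio_eq, smul_eq_mul, cG2]
  ring

lemma cRatio_mul (γ δ : SL(2, ℤ)) (z : ℍ) : cRatio (γ * δ) z =
    cRatio γ (δ • z) * UpperHalfPlane.denom (δ : GL (Fin 2) ℝ) z ^ (-2 : ℤ) + cRatio δ z := by
  have h := congrFun (EisensteinSeries.D2_mul γ δ) z
  rw [Pi.add_apply, ModularForm.SL_slash_apply, cRatio_eq, cRatio_eq, cRatio_eq] at h
  have h2 : (2 * Real.pi * Complex.I : ℂ) ≠ 0 := by simp [Real.pi_ne_zero]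
  apply mul_left_cancel₀ h2
  rw [h]; ring

lemma infinite_cRatio (N : ℕ) (hN : N ≠ 0) (z : ℍ) :
    {t : ℂ | ∃ γ ∈ CongruenceSubgroup.Gamma N, cRatio γ z = t}.Infinite := by
  let g : ℕ → SL(2, ℤ) := fun n => ⟨!![1, 0; (N : ℤ) * n, 1], by simp [Matrix.det_fin_two]⟩
  refine Set.infinite_of_injective_forall_mem (f := fun n => cRatio (g n) z) ?_ ?_
  · intro m n h
    have hd : ∀ n : ℕ, ((N : ℂ) * n * z + 1) ≠ 0 := by
      intro n hn
      have := UpperHalfPlane.denom_ne_zero (g n : GL (Fin 2) ℝ) z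
      rw [denom_eq] at this
      apply this
      simpa [g] using hn
    have hmn : (N : ℂ) * m / ((N : ℂ) * m * z + 1) = (N : ℂ) * n / ((N : ℂ) * n * z + 1) := by
      simpa [cRatio, g] using h
    rw [div_eq_div_iff (hd m) (hd n)] at hmn
    have : (N : ℂ) * m = N * n := by linear_combination hmn
    have := mul_left_cancel₀ (by exact_mod_cast hN) this
    exact_mod_cast this
  · intro n
    refine ⟨g n, ?_, rfl⟩
    rw [CongruenceSubgroup.Gamma_mem]
    simp [g]

/-- Auxiliary: the components of `G₂`. -/
def polyG2 : (ℍ → ℂ)[X] :=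
  Polynomial.C eisG2 + Polynomial.C (Function.const ℍ cG2) * Polynomial.X

lemma hasPoly_G2 (N : ℕ) : HasPoly N 2 polyG2 eisG2 := by
  have hE : HoloBdd 2 eisG2 := by
    refine ⟨?_, fun δ => ?_⟩
    · rw [eisG2_eq]
      exact E2_mdifferentiable.const_smul _
    · rw [eisG2_slash]
      refine Filter.BoundedAtFilter.add ?_ (Asymptotics.IsBigO.const_smul_left ?_ _)
      · rw [eisG2_eq]
        exact EisensteinSeries.isBoundedAtImInfty_E2.const_smul_left _
      · change IsBoundedAtImInfty _
        rw [UpperHalfPlane.isBoundedAtImInfty_iff]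
        refine ⟨1, 1, fun z hz => ?_⟩
        rw [cRatio]
        by_cases hc : (δ 1 0 : ℤ) = 0
        · simp [hc]
        rw [norm_div]
        have h1 : ‖((δ 1 0 : ℤ) : ℂ)‖ ≤ ‖((δ 1 0 : ℤ) : ℂ) * z + ((δ 1 1 : ℤ) : ℂ)‖ := by
          refine le_trans ?_ (Complex.abs_im_le_norm _)
          have : ((z : ℂ)).im = z.im := rfl
          simp only [Complex.add_im, Complex.mul_im, Complex.intCast_re, Complex.intCast_im,
            zero_mul, add_zero, abs_mul, Complex.norm_intCast, this]
          exact le_mul_of_one_le_right (abs_nonneg _) (le_trans hz (le_abs_self _))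
        exact div_le_one_of_le₀ h1 (norm_nonneg _)
  refine ⟨fun j => ?_, fun γ hγ z => ?_⟩
  · rw [polyG2, Polynomial.coeff_add, Polynomial.coeff_C_mul, Polynomial.coeff_C,
      Polynomial.coeff_X]
    rcases j with _ | _ | j
    · simpa using hE
    · have h1 : Function.const ℍ cG2 = cG2 • (1 : ℍ → ℂ) := by ext; simp
      simpa [h1] using HoloBdd.one.smul cG2
    · simpa using HoloBdd.zero _
  · rw [eisG2_slash]
    simp [polyG2, Polynomial.eval₂_add, Polynomial.eval₂_mul]

lemma hasPoly_G2_pow (N : ℕ) (i : ℕ) :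
    HasPoly N (2 * (i : ℤ)) (polyG2 ^ i) (eisG2 ^ i) := by
  induction i with
  | zero =>
    refine ⟨fun j => ?_, fun γ hγ z => ?_⟩
    · rw [pow_zero, Polynomial.coeff_one]
      split_ifs with h
      · simpa [h] using HoloBdd.one
      · exact HoloBdd.zero _
    · simp only [pow_zero, Polynomial.eval₂_one]
      simpa using congrFun (ModularForm.is_invariant_one γ) z
  | succ i ih =>
    have := ih.mul (hasPoly_G2 N)
    rw [pow_succ, pow_succ]
    convert this using 1
    push_cast; ring

lemma HasPoly.top_modular {N : ℕ} [NeZero N] {k : ℤ} {p : (ℍ → ℂ)[X]} {f : ℍ → ℂ}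
    (hf : HasPoly N k p f) {s : ℕ} (hs : p.degree < ((s + 1 : ℕ) : WithBot ℕ)) :
    IsModular N (k - 2 * (s : ℤ)) (p.coeff s) := by
  rw [isModular_iff]
  refine ⟨hf.1 s, fun δ hδ => ?_⟩
  ext z
  set x := cRatio δ z
  -- both sides as polynomials in `T`
  let P : ℂ[X] := ∑ j ∈ Finset.range (s + 1), Polynomial.C (p.coeff j z) * Polynomial.X ^ j
  let Q : ℂ[X] := ∑ j ∈ Finset.range (s + 1),
    Polynomial.C ((p.coeff j ∣[k - 2 * (j : ℤ)] δ) z) * (Polynomial.X + Polynomial.C (-x)) ^ j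
  have hev : ∀ (t : ℂ) (w : ℍ), p.eval₂ (Pi.evalRingHom (fun _ : ℍ => ℂ) w) t =
      ∑ j ∈ Finset.range (s + 1), p.coeff j w * t ^ j := by
    intro t w
    by_cases h0 : p = 0
    · simp [h0]
    · rw [Polynomial.eval₂_eq_sum_range' _
        ((Polynomial.natDegree_lt_iff_degree_lt h0).2 hs)]
      rfl
  have hPQ : P = Q := by
    apply Polynomial.eq_of_infinite_eval_eq
    refine (infinite_cRatio N (NeZero.ne N) z).mono ?_
    rintro t ⟨γ', hγ', rfl⟩
    obtain ⟨γ, hγ, rfl⟩ : ∃ γ ∈ CongruenceSubgroup.Gamma N, γ' = γ * δ :=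
      ⟨γ' * δ⁻¹, mul_mem hγ' (inv_mem hδ), by group⟩
    have h1 := hf.2 (γ * δ) hγ' z
    rw [SlashAction.slash_mul, ModularForm.SL_slash_apply, hf.2 γ hγ, hev, hev] at h1
    change Polynomial.eval _ P = Polynomial.eval _ Q
    simp only [P, Q, Polynomial.eval_finsetSum, Polynomial.eval_mul, Polynomial.eval_C,
      Polynomial.eval_pow, Polynomial.eval_X, Polynomial.eval_add]
    rw [← h1, Finset.sum_mul]
    refine Finset.sum_congr rfl fun j _ => ?_
    have hd := UpperHalfPlane.denom_ne_zero (δ : GL (Fin 2) ℝ) z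
    rw [cRatio_mul, ModularForm.SL_slash_apply, add_neg_cancel_right, mul_pow,
      ← zpow_natCast, ← zpow_natCast, ← zpow_mul]
    have : UpperHalfPlane.denom (δ : GL (Fin 2) ℝ) z ^ (-k) =
        UpperHalfPlane.denom (δ : GL (Fin 2) ℝ) z ^ (-(k - 2 * (j : ℤ))) *
          UpperHalfPlane.denom (δ : GL (Fin 2) ℝ) z ^ (-2 * (j : ℤ)) := by
      rw [← zpow_add₀ hd]; congr 1; ring
    rw [this]; ring
  have hc := congrArg (fun R => Polynomial.coeff R s) hPQ
  have hP : P.coeff s = p.coeff s z := by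
    simp [P, Polynomial.finsetSum_coeff, Polynomial.coeff_C_mul, Polynomial.coeff_X_pow]
  have hQ : Q.coeff s = (p.coeff s ∣[k - 2 * (s : ℤ)] δ) z := by
    simp only [Q, Polynomial.finsetSum_coeff, Polynomial.coeff_C_mul,
      Polynomial.coeff_X_add_C_pow]
    rw [Finset.sum_eq_single s]
    · simp
    · intro j hj hjs
      have : j < s := by have := Finset.mem_range.1 hj; omega
      simp [Nat.choose_eq_zero_of_lt this]
    · simp
  simp only [hP, hQ] at hc
  exact hc.symm

/-- Multiplication by `G₂ ^ i`, as a map from modular forms of weight `k - 2 i` to quasimodular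
forms of weight `k`. -/
def expandComp (k : ℤ) (i : ℕ) : modTower (k - 2 * (i : ℤ)) →ₗ[ℂ] quasiTower k where
  toFun a := ⟨(a : ℍ → ℂ) * eisG2 ^ i, by
    have h1 := modTower_le_quasiTower _ a.2
    have h2 : eisG2 ^ i ∈ quasiTower (2 * (i : ℤ)) :=
      mem_quasiTower.2 ⟨1, one_ne_zero, _, hasPoly_G2_pow 1 i⟩
    have := quasiTower_mul h1 h2
    rwa [sub_add_cancel] at this⟩
  map_add' a b := Subtype.ext (add_mul _ _ _)
  map_smul' c a := Subtype.ext (smul_mul_assoc c _ _)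

/-- The map `(a_i) ↦ ∑ a_i G₂ ^ i`. -/
def expandMap (k : ℤ) : (⨁ i : ℕ, modTower (k - 2 * (i : ℤ))) →ₗ[ℂ] quasiTower k :=
  DirectSum.toModule ℂ ℕ _ (expandComp k)

open scoped Classical in
lemma coe_expandMap (k : ℤ) (x : ⨁ i : ℕ, modTower (k - 2 * (i : ℤ))) (z : ℍ) :
    (expandMap k x : ℍ → ℂ) z =
      ∑ i ∈ DFinsupp.support x, (x i : ℍ → ℂ) z * eisG2 z ^ i := by
  conv_lhs => rw [← DirectSum.sum_support_of x]
  rw [map_sum, Submodule.coe_sum, Finset.sum_apply]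
  refine Finset.sum_congr rfl fun i _ => ?_
  change ((DirectSum.toModule ℂ ℕ _ (expandComp k) (DirectSum.lof ℂ ℕ _ i (x i)) :
    quasiTower k) : ℍ → ℂ) z = _
  rw [DirectSum.toModule_lof]
  rfl

lemma expandMap_injective (k : ℤ) : Function.Injective (expandMap k) := by
  classical
  rw [injective_iff_map_eq_zero]
  intro x hx
  have hlev : ∀ i : ℕ, ∃ N : ℕ, N ≠ 0 ∧ IsModular N (k - 2 * (i : ℤ)) (x i) :=
    fun i => (x i).2
  choose L hL0 hL using hlev
  set N := ∏ i ∈ DFinsupp.support x, L i with hN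
  have hN0 : N ≠ 0 := Finset.prod_ne_zero_iff.2 fun i _ => hL0 i
  have : NeZero N := ⟨hN0⟩
  ext i z
  by_contra hne
  have hi : i ∈ DFinsupp.support x := by
    rw [DFinsupp.mem_support_toFun]
    intro h; apply hne; rw [h]; rfl
  have hinv : ∀ γ ∈ CongruenceSubgroup.Gamma N, ∀ j ∈ DFinsupp.support x,
      (x j : ℍ → ℂ) ∣[k - 2 * (j : ℤ)] γ = x j := by
    intro γ hγ j hj
    have : NeZero (L j) := ⟨hL0 j⟩
    exact (isModular_iff.1 ((hL j).level_mono (Finset.dvd_prod_of_mem L hj))).2 γ hγ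
  let R : ℂ[X] := ∑ j ∈ DFinsupp.support x,
    Polynomial.C ((x j : ℍ → ℂ) z) * (Polynomial.X) ^ j
  have hR : R = 0 := by
    apply Polynomial.eq_zero_of_infinite_isRoot
    have hinf := (infinite_cRatio N hN0 z).image
      (f := fun t => eisG2 z + cG2 * t) (fun a _ b _ h => by simpa [cG2_ne] using h)
    refine hinf.mono ?_
    rintro _ ⟨_, ⟨γ, hγ, rfl⟩, rfl⟩
    have h0 : ((expandMap k x : ℍ → ℂ) ∣[k] γ) z = 0 := by rw [hx]; simp
    have hfun : (expandMap k x : ℍ → ℂ) =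
        ∑ j ∈ DFinsupp.support x, (x j : ℍ → ℂ) * eisG2 ^ j := by
      ext w; rw [coe_expandMap, Finset.sum_apply]; rfl
    rw [hfun, SlashAction.sum_slash, Finset.sum_apply] at h0
    change Polynomial.eval _ R = 0
    rw [← h0]
    simp only [R, Polynomial.eval_finsetSum, Polynomial.eval_mul, Polynomial.eval_C,
      Polynomial.eval_pow, Polynomial.eval_X]
    refine Finset.sum_congr rfl fun j hj => ?_
    have h1 := ModularForm.mul_slash_SL2 (k - 2 * (j : ℤ)) (2 * (j : ℤ)) γ (x j) (eisG2 ^ j)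
    rw [sub_add_cancel] at h1
    rw [h1, hinv γ hγ j hj, Pi.mul_apply, (hasPoly_G2_pow N j).2 γ hγ z]
    simp [polyG2, Polynomial.eval₂_pow, Polynomial.eval₂_add, Polynomial.eval₂_mul]
  have hc := congrArg (fun R => Polynomial.coeff R i) hR
  apply hne
  simpa [R, Polynomial.finsetSum_coeff, Polynomial.coeff_C_mul, Polynomial.coeff_X_pow,
    Finset.sum_ite_eq, hi] using hc

lemma mem_range_expandMap (k : ℤ) (N : ℕ) [NeZero N] (s : ℕ) : ∀ (p : (ℍ → ℂ)[X]) (f : ℍ → ℂ),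
    HasPoly N k p f → p.degree < (s : WithBot ℕ) →
      ∃ x, (expandMap k x : ℍ → ℂ) = f := by
  induction s with
  | zero =>
    intro p f hf hp
    have : p = 0 := by
      rw [← Polynomial.degree_eq_bot]; simpa using hp
    refine ⟨0, ?_⟩
    rw [hf.eq_coeff_zero, this]; simp
  | succ s ih =>
    intro p f hf hp
    have hm := hf.top_modular hp
    set a : ℍ → ℂ := p.coeff s with ha
    let a' : modTower (k - 2 * (s : ℤ)) := ⟨a, N, NeZero.ne N, hm⟩
    have hq := (hasPoly_of_isModular hm).mul (hasPoly_G2_pow N s)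
    rw [sub_add_cancel] at hq
    have hsub := hf.add (hq.smul (-(cG2 ^ s)⁻¹))
    obtain ⟨y, hy⟩ := ih _ _ hsub (by
      rw [Polynomial.degree_lt_iff_coeff_zero]
      intro m hms
      have hlin : polyG2.natDegree ≤ 1 := by
        rw [polyG2]
        compute_degree
      have hpow : (polyG2 ^ s).natDegree ≤ s := by
        simpa using Polynomial.natDegree_pow_le_of_le s hlin
      rw [Polynomial.coeff_add, Polynomial.coeff_smul, Polynomial.coeff_C_mul]
      rcases hms.eq_or_lt with rfl | hlt
      · have h1 : (polyG2 ^ s).coeff s = Function.const ℍ cG2 ^ s := by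
          have := Polynomial.coeff_pow_of_natDegree_le (m := s) hlin
          rw [mul_one] at this
          rw [this, polyG2]
          simp
        rw [h1, ← ha]
        ext z
        have := pow_ne_zero s cG2_ne
        simp only [Pi.add_apply, Pi.smul_apply, Pi.mul_apply, Pi.pow_apply, Function.const_apply,
          smul_eq_mul, Pi.zero_apply]
        field_simp
        ring
      · rw [Polynomial.coeff_eq_zero_of_natDegree_lt (lt_of_le_of_lt hpow hlt),
          (Polynomial.degree_lt_iff_coeff_zero _ _).1 hp m hlt]
        simp)
    refine ⟨y + DirectSum.lof ℂ ℕ (fun i : ℕ => modTower (k - 2 * (i : ℤ))) s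
      ((cG2 ^ s)⁻¹ • a'), ?_⟩
    rw [map_add, Submodule.coe_add, hy]
    have : (expandMap k (DirectSum.lof ℂ ℕ (fun i : ℕ => modTower (k - 2 * (i : ℤ))) s
      ((cG2 ^ s)⁻¹ • a')) : ℍ → ℂ) = ((cG2 ^ s)⁻¹ • a) * eisG2 ^ s := by
      rw [expandMap, DirectSum.toModule_lof]; rfl
    rw [this, smul_mul_assoc, neg_smul, add_assoc, neg_add_cancel, add_zero]

lemma expandMap_bijective (k : ℤ) : Function.Bijective (expandMap k) := by
  refine ⟨expandMap_injective k, fun f => ?_⟩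
  obtain ⟨N, hN, p, hp⟩ := mem_quasiTower.1 f.2
  have : NeZero N := ⟨hN⟩
  obtain ⟨x, hx⟩ := mem_range_expandMap k N (p.natDegree + 1) p f hp (by
    by_cases h0 : p = 0
    · simp [h0]
    · rw [← Polynomial.natDegree_lt_iff_degree_lt h0]; omega)
  exact ⟨x, Subtype.ext hx⟩

/-- The expansion `f = ∑ a_i(f) G₂ ^ i` with modular coefficients `a_i(f)` of weight `k - 2 i`:
the inverse of this isomorphism sends `f` to `(a_i(f))`. -/
def expand (k : ℤ) : (⨁ i : ℕ, modTower (k - 2 * (i : ℤ))) ≃ₗ[ℂ] quasiTower k :=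
  LinearEquiv.ofBijective (expandMap k) (expandMap_bijective k)

lemma expand_lof (k : ℤ) (i : ℕ) (a : modTower (k - 2 * (i : ℤ))) :
    expand k (DirectSum.lof ℂ ℕ _ i a) = expandComp k i a := by
  rw [expand, LinearEquiv.ofBijective_apply, expandMap, DirectSum.toModule_lof]

/-! ### Operators on the modular tower -/

/-- The weight `w` slash action of `SL(2, ℤ)` on the modular tower. -/
def modSlash (w : ℤ) (γ : SL(2, ℤ)) : modTower w →ₗ[ℂ] modTower w where
  toFun f := ⟨(f : ℍ → ℂ) ∣[w] γ, modTower_slash f.2 γ⟩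
  map_add' f g := Subtype.ext (SlashAction.add_slash w γ (f : ℍ → ℂ) g)
  map_smul' c f := Subtype.ext (ModularForm.SL_smul_slash w γ (f : ℍ → ℂ) c)

/-- The discriminant `Δ = (2π)¹² q ∏ (1 - qⁿ)²⁴ = (2π)¹² η²⁴` on the upper half plane. -/
def Delta (z : ℍ) : ℂ := (2 * Real.pi) ^ 12 * ModularForm.discriminant z

/-- The Ramanujan differential operator in weight `w`:
`f ↦ (2πi)⁻¹ f' - (12πi)⁻¹ (log Δ)' (w / 2) f`. -/
def ramanujan (w : ℤ) (f : ℍ → ℂ) (z : ℍ) : ℂ :=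
  1 / (2 * Real.pi * Complex.I) * deriv (f ∘ UpperHalfPlane.ofComplex) z -
    1 / (12 * Real.pi * Complex.I) * logDeriv (Delta ∘ UpperHalfPlane.ofComplex) z *
      (((w : ℂ) / 2) * f z)

lemma logDeriv_Delta (z : ℍ) : logDeriv (Delta ∘ UpperHalfPlane.ofComplex) z =
    2 * Real.pi * Complex.I * EisensteinSeries.E2 z := by
  have hev : (Delta ∘ UpperHalfPlane.ofComplex) =ᶠ[nhds (z : ℂ)]
      fun w => ((2 * Real.pi) ^ 12 : ℂ) * ModularForm.eta w ^ 24 := by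
    filter_upwards [UpperHalfPlane.isOpen_upperHalfPlaneSet.mem_nhds z.im_pos] with w hw
    simp [Delta, ModularForm.discriminant, UpperHalfPlane.ofComplex_apply_of_im_pos hw]
  have hd := ModularForm.differentiableAt_eta_of_mem_upperHalfPlaneSet z.im_pos
  have hne := ModularForm.eta_ne_zero z.im_pos
  rw [logDeriv_apply, hev.deriv_eq, hev.eq_of_nhds, ← logDeriv_apply,
    logDeriv_const_mul _ _ (by simp [Real.pi_ne_zero]), logDeriv_fun_pow hd,
    ModularForm.logDeriv_eta_eq_E2]
  push_cast
  ring

lemma ramanujan_eq (w : ℤ) (f : ℍ → ℂ) : ramanujan w f = Derivative.serreDerivative w f := by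
  ext z
  rw [ramanujan, logDeriv_Delta, Derivative.serreDerivative_apply,
    Derivative.normalizedDerivOfComplex]
  have : (Real.pi : ℂ) ≠ 0 := by simp [Real.pi_ne_zero]
  field_simp

lemma isBoundedAtImInfty_deriv {f : ℍ → ℂ} (hf : MDiff f) (hb : IsBoundedAtImInfty f) :
    IsBoundedAtImInfty (Derivative.normalizedDerivOfComplex f) := by
  rw [UpperHalfPlane.isBoundedAtImInfty_iff] at hb ⊢
  obtain ⟨M, A, h⟩ := hb
  rw [UpperHalfPlane.mdifferentiable_iff] at hf
  refine ⟨‖(2 * Real.pi * Complex.I : ℂ)⁻¹‖ * (M / (1 / 2)), max A 0 + 1, fun z hz => ?_⟩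
  rw [Derivative.normalizedDerivOfComplex, norm_mul]
  refine mul_le_mul_of_nonneg_left ?_ (norm_nonneg _)
  have him : ∀ w ∈ Metric.closedBall (z : ℂ) (1 / 2), max A 0 < w.im := by
    intro w hw
    have h1 : |w.im - z.im| ≤ 1 / 2 := by
      have := Complex.abs_im_le_norm (w - z)
      rw [Complex.sub_im] at this
      exact this.trans (by simpa [dist_eq_norm] using hw)
    have := (abs_le.1 h1).1
    linarith
  apply Complex.norm_deriv_le_of_forall_mem_sphere_norm_le (by norm_num)
  · apply DifferentiableOn.diffContOnCl
    rw [closure_ball _ (by norm_num)]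
    exact hf.mono fun w hw => lt_of_le_of_lt (le_max_right A 0) (him w hw)
  · intro w hw
    have hw' := him w (Metric.sphere_subset_closedBall hw)
    have hpos : 0 < w.im := lt_of_le_of_lt (le_max_right A 0) hw'
    rw [Function.comp_apply, UpperHalfPlane.ofComplex_apply_of_im_pos hpos]
    exact h _ (le_trans (le_max_left A 0) hw'.le)

lemma ramanujan_slash {w : ℤ} {f : ℍ → ℂ} (hf : MDiff f) (γ : SL(2, ℤ)) :
    ramanujan w f ∣[w + 2] γ = ramanujan w (f ∣[w] γ) := by
  rw [ramanujan_eq, ramanujan_eq, Derivative.serreDerivative_slash_equivariant hf]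

lemma modTower_holo {w : ℤ} {f : ℍ → ℂ} (hf : f ∈ modTower w) : MDiff f := by
  obtain ⟨N, hN, hf⟩ := hf
  have : NeZero N := ⟨hN⟩
  exact (isModular_iff.1 hf).1.1

lemma modTower_ramanujan {w : ℤ} {f : ℍ → ℂ} (hf : f ∈ modTower w) :
    ramanujan w f ∈ modTower (w + 2) := by
  obtain ⟨N, hN, hf⟩ := hf
  have : NeZero N := ⟨hN⟩
  obtain ⟨⟨h1, h2⟩, h3⟩ := isModular_iff.1 hf
  refine ⟨N, hN, isModular_iff.2 ⟨⟨?_, fun δ => ?_⟩, fun γ hγ => ?_⟩⟩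
  · rw [ramanujan_eq]; exact Derivative.serreDerivative_mdifferentiable _ h1
  · rw [ramanujan_slash h1, ramanujan_eq]
    have hb := isBoundedAtImInfty_deriv (h1.slash w (δ : GL (Fin 2) ℝ)) (h2 δ)
    have hE := (EisensteinSeries.isBoundedAtImInfty_E2.mul (h2 δ)).const_smul_left
      ((w : ℂ) * 12⁻¹)
    have := Filter.BoundedAtFilter.add hb (Filter.BoundedAtFilter.neg hE)
    refine this.congr_left fun z => ?_
    simp only [Pi.add_apply, Pi.neg_apply, Pi.smul_apply, Pi.mul_apply, smul_eq_mul,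
      Derivative.serreDerivative_apply]
    change Derivative.normalizedDerivOfComplex (f ∣[w] δ) z + _ = _
    ring
  · rw [ramanujan_slash h1, h3 γ hγ]

/-- The Ramanujan operator `X` on the weight `w` part of the modular tower, with values in weight
`w' = w + 2`. -/
def modX (w w' : ℤ) (h : w' = w + 2) : modTower w →ₗ[ℂ] modTower w' where
  toFun f := ⟨ramanujan w (f : ℍ → ℂ), h ▸ modTower_ramanujan f.2⟩
  map_add' f g := Subtype.ext (by
    simp only [ramanujan_eq, Submodule.coe_add]
    exact Derivative.serreDerivative_add _ _ _ (modTower_holo f.2) (modTower_holo g.2))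
  map_smul' c f := Subtype.ext (by
    simp only [ramanujan_eq, Submodule.coe_smul, RingHom.id_apply]
    exact Derivative.serreDerivative_smul _ _ _ (modTower_holo f.2))

/-- The operator `Y` on the weight `w` part of the modular tower: multiplication by `w / 2`. -/
def modY (w : ℤ) : modTower w →ₗ[ℂ] modTower w := ((w : ℂ) / 2) • LinearMap.id

/-! ### The quasimodular tower and its operators -/

/-- The part of weight `k ≥ 0` of the quasimodular tower. -/
abbrev quasiGr (k : ℕ) : Submodule ℂ (ℍ → ℂ) := quasiTower (k : ℤ)

instance quasiGr_gradedMonoid : SetLike.GradedMonoid quasiGr where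
  one_mem := by
    refine modTower_le_quasiTower _ ⟨1, one_ne_zero, isModular_iff.2 ⟨?_, fun γ _ => ?_⟩⟩
    · simpa using HoloBdd.one
    · simpa using ModularForm.is_invariant_one γ
  mul_mem := by
    intro k l f g hf hg
    have := quasiTower_mul hf hg
    exact this

/-- The quasimodular tower, a commutative `ℂ`-algebra graded by the weight. -/
abbrev QM : Type := ⨁ k : ℕ, quasiGr k

/-- `f ↦ f || γ` in weight `k`: the slash action applied to the modular coefficients `a_i(f)`. -/
def quasiSlash (γ : SL(2, ℤ)) (k : ℕ) : quasiGr k →ₗ[ℂ] quasiGr k :=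
  (expand k).toLinearMap ∘ₗ
    DirectSum.lmap (fun i : ℕ => modSlash ((k : ℤ) - 2 * (i : ℤ)) γ) ∘ₗ
      (expand k).symm.toLinearMap

/-- `X` in weight `k`: the Ramanujan operator applied to the modular coefficients `a_i(f)`. -/
def quasiX (k : ℕ) : quasiGr k →ₗ[ℂ] quasiGr (k + 2) :=
  (expand ((k + 2 : ℕ) : ℤ)).toLinearMap ∘ₗ
    DirectSum.lmap (fun i : ℕ => modX ((k : ℤ) - 2 * (i : ℤ)) (((k + 2 : ℕ) : ℤ) - 2 * (i : ℤ))
      (by push_cast; ring)) ∘ₗ (expand k).symm.toLinearMap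

/-- `Y` in weight `k`: the weight operator applied to the modular coefficients `a_i(f)`. -/
def quasiY (k : ℕ) : quasiGr k →ₗ[ℂ] quasiGr k :=
  (expand k).toLinearMap ∘ₗ
    DirectSum.lmap (fun i : ℕ => modY ((k : ℤ) - 2 * (i : ℤ))) ∘ₗ (expand k).symm.toLinearMap

/-- The operation `f ↦ f || γ` on the quasimodular tower. -/
def slashQM (γ : SL(2, ℤ)) : QM →ₗ[ℂ] QM := DirectSum.lmap (quasiSlash γ)

/-- The operator `X` on the quasimodular tower. -/
def XQM : QM →ₗ[ℂ] QM :=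
  DirectSum.toModule ℂ ℕ QM fun k => DirectSum.lof ℂ ℕ (fun k => quasiGr k) (k + 2) ∘ₗ quasiX k

/-- The operator `Y` on the quasimodular tower. -/
def YQM : QM →ₗ[ℂ] QM := DirectSum.lmap quasiY

/-- The element `a G₂ ^ i` of weight `k` of the quasimodular tower. -/
def gen (k i : ℕ) (a : modTower ((k : ℤ) - 2 * (i : ℤ))) : QM :=
  DirectSum.lof ℂ ℕ (fun k => quasiGr k) k (expandComp k i a)

lemma QM_hom_ext {M : Type*} [AddCommMonoid M] [Module ℂ M] {f g : QM →ₗ[ℂ] M}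
    (h : ∀ k i a, f (gen k i a) = g (gen k i a)) : f = g := by
  apply DirectSum.linearMap_ext
  intro k
  have : (f ∘ₗ DirectSum.lof ℂ ℕ (fun k => quasiGr k) k) ∘ₗ (expand k).toLinearMap =
      (g ∘ₗ DirectSum.lof ℂ ℕ (fun k => quasiGr k) k) ∘ₗ (expand k).toLinearMap := by
    apply DirectSum.linearMap_ext
    intro i
    ext a
    simp only [LinearMap.comp_apply, LinearEquiv.coe_coe, expand_lof]
    exact h k i a
  ext x
  have h2 := LinearMap.congr_fun this ((expand k).symm x)
  simpa using h2

lemma slashQM_gen (γ : SL(2, ℤ)) (k i : ℕ) (a : modTower ((k : ℤ) - 2 * (i : ℤ))) :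
    slashQM γ (gen k i a) = gen k i (modSlash _ γ a) := by
  rw [slashQM, gen, DirectSum.lmap_lof, gen]
  congr 1
  rw [← expand_lof, quasiSlash, LinearMap.comp_apply, LinearMap.comp_apply, LinearEquiv.coe_coe,
    LinearEquiv.coe_coe, LinearEquiv.symm_apply_apply, DirectSum.lmap_lof, expand_lof]

lemma XQM_gen (k i : ℕ) (a : modTower ((k : ℤ) - 2 * (i : ℤ))) :
    XQM (gen k i a) = gen (k + 2) i (modX _ _ (by push_cast; ring) a) := by
  rw [XQM, gen, DirectSum.toModule_lof, gen, LinearMap.comp_apply]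
  congr 1
  rw [← expand_lof, quasiX, LinearMap.comp_apply, LinearMap.comp_apply, LinearEquiv.coe_coe,
    LinearEquiv.coe_coe, LinearEquiv.symm_apply_apply, DirectSum.lmap_lof, expand_lof]

lemma YQM_gen (k i : ℕ) (a : modTower ((k : ℤ) - 2 * (i : ℤ))) :
    YQM (gen k i a) = gen k i (modY _ a) := by
  rw [YQM, gen, DirectSum.lmap_lof, gen]
  congr 1
  rw [← expand_lof, quasiY, LinearMap.comp_apply, LinearMap.comp_apply, LinearEquiv.coe_coe,
    LinearEquiv.coe_coe, LinearEquiv.symm_apply_apply, DirectSum.lmap_lof, expand_lof]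

lemma gen_mul (k l i j : ℕ) (a : modTower ((k : ℤ) - 2 * (i : ℤ)))
    (b : modTower ((l : ℤ) - 2 * (j : ℤ)))
    (c : modTower (((k + l : ℕ) : ℤ) - 2 * ((i + j : ℕ) : ℤ)))
    (hc : (c : ℍ → ℂ) = (a : ℍ → ℂ) * b) : gen k i a * gen l j b = gen (k + l) (i + j) c := by
  simp only [gen, DirectSum.lof_eq_of]
  rw [DirectSum.of_mul_of]
  congr 1
  apply Subtype.ext
  change ((a : ℍ → ℂ) * eisG2 ^ i) * ((b : ℍ → ℂ) * eisG2 ^ j) = (c : ℍ → ℂ) * eisG2 ^ (i + j)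
  rw [hc, pow_add]; ring

lemma slashQM_one (f : QM) : slashQM 1 f = f := by
  have : slashQM 1 = LinearMap.id := QM_hom_ext fun k i a => by
    rw [slashQM_gen]
    congr 1
    exact Subtype.ext (SlashAction.slash_one _ _)
  rw [this]; rfl

lemma slashQM_slashQM (γ δ : SL(2, ℤ)) (f : QM) :
    slashQM δ (slashQM γ f) = slashQM (γ * δ) f := by
  have : slashQM δ ∘ₗ slashQM γ = slashQM (γ * δ) := QM_hom_ext fun k i a => by
    rw [LinearMap.comp_apply, slashQM_gen, slashQM_gen, slashQM_gen]
    congr 1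
    exact Subtype.ext (SlashAction.slash_mul _ _ _ _).symm
  exact LinearMap.congr_fun this f

lemma slashQM_XQM (γ : SL(2, ℤ)) (f : QM) : slashQM γ (XQM f) = XQM (slashQM γ f) := by
  have : slashQM γ ∘ₗ XQM = XQM ∘ₗ slashQM γ := QM_hom_ext fun k i a => by
    rw [LinearMap.comp_apply, LinearMap.comp_apply, slashQM_gen, XQM_gen, XQM_gen, slashQM_gen]
    congr 1
    apply Subtype.ext
    change ramanujan _ (a : ℍ → ℂ) ∣[_] γ = ramanujan _ ((a : ℍ → ℂ) ∣[_] γ)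
    rw [← ramanujan_slash (modTower_holo a.2)]
    congr 1; push_cast; ring
  exact LinearMap.congr_fun this f

lemma slashQM_YQM (γ : SL(2, ℤ)) (f : QM) : slashQM γ (YQM f) = YQM (slashQM γ f) := by
  have : slashQM γ ∘ₗ YQM = YQM ∘ₗ slashQM γ := QM_hom_ext fun k i a => by
    rw [LinearMap.comp_apply, LinearMap.comp_apply, slashQM_gen, YQM_gen, YQM_gen, slashQM_gen]
    congr 1
    simp [modY]
  exact LinearMap.congr_fun this f

lemma QM_induction {p : QM → Prop} (h0 : p 0) (hadd : ∀ f g, p f → p g → p (f + g))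
    (hgen : ∀ k i a, p (gen k i a)) (f : QM) : p f := by
  induction f using DirectSum.induction_on with
  | zero => exact h0
  | add f g hf hg => exact hadd f g hf hg
  | of k x =>
    obtain ⟨y, rfl⟩ := (expand (k : ℤ)).surjective x
    induction y using DirectSum.induction_on with
    | zero => simpa using h0
    | add f g hf hg => rw [map_add, map_add]; exact hadd _ _ hf hg
    | of i a =>
      have := hgen k i a
      rw [gen, ← expand_lof] at this
      exact this

lemma slashQM_mul (γ : SL(2, ℤ)) (f g : QM) :
    slashQM γ (f * g) = slashQM γ f * slashQM γ g := by
  induction f using QM_induction with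
  | h0 => simp
  | hadd f f' hf hf' => simp [add_mul, hf, hf']
  | hgen k i a =>
    induction g using QM_induction with
    | h0 => simp
    | hadd f f' hf hf' => simp [mul_add, hf, hf']
    | hgen l j b =>
      have hw : ((k : ℤ) - 2 * (i : ℤ)) + ((l : ℤ) - 2 * (j : ℤ)) =
        ((k + l : ℕ) : ℤ) - 2 * ((i + j : ℕ) : ℤ) := by push_cast; ring
      have hm : (a : ℍ → ℂ) * b ∈ modTower (((k + l : ℕ) : ℤ) - 2 * ((i + j : ℕ) : ℤ)) :=
        hw ▸ modTower_mul a.2 b.2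
      rw [gen_mul k l i j a b ⟨_, hm⟩ rfl, slashQM_gen, slashQM_gen, slashQM_gen]
      symm
      apply gen_mul
      have := ModularForm.mul_slash_SL2 ((k : ℤ) - 2 * (i : ℤ)) ((l : ℤ) - 2 * (j : ℤ)) γ a b
      rw [hw] at this
      exact this

/-! ### Twisted quasimodular Hecke operators -/

/-- The inclusion of `SL(2, ℤ)` in `GL(2, ℚ)⁺`. -/
def slGL : SL(2, ℤ) →* GL(2, ℚ)⁺ :=
  Matrix.SpecialLinearGroup.toGLPos.comp
    (Matrix.SpecialLinearGroup.map (Int.castRingHom ℚ))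

/-- `Γ(N)` as a subgroup of `GL(2, ℚ)⁺`. -/
def GammaGL (N : ℕ) : Subgroup GL(2, ℚ)⁺ := (CongruenceSubgroup.Gamma N).map slGL

/-- The set of left cosets `Γ(N)\GL(2, ℚ)⁺` (cosets of the form `Γ(N) α`). -/
abbrev CosetGL (N : ℕ) : Type := Quotient (QuotientGroup.rightRel (GammaGL N))

/-- The set of left cosets `Γ(N)\SL(2, ℤ)` (cosets of the form `Γ(N) β`). -/
abbrev CosetSL (N : ℕ) : Type := Quotient (QuotientGroup.rightRel (CongruenceSubgroup.Gamma N))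

lemma mk_mul_left {N : ℕ} {γ : SL(2, ℤ)} (hγ : γ ∈ CongruenceSubgroup.Gamma N) (α : GL(2, ℚ)⁺) :
    (Quotient.mk _ (slGL γ * α) : CosetGL N) = Quotient.mk _ α := by
  apply Quotient.sound
  rw [← Quotient.eq_iff_equiv, Quotient.eq, QuotientGroup.rightRel_apply]
  refine ⟨γ⁻¹, inv_mem hγ, ?_⟩
  rw [map_inv]; group

/-- The space `𝒬_σ(Γ(N))` of `σ`-twisted quasimodular Hecke operators of level `Γ(N)`: functions
of finite support on `Γ(N)\GL(2, ℚ)⁺` with values in the quasimodular tower, regarded as left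
`Γ(N)`-invariant functions on `GL(2, ℚ)⁺`, such that `F_{αγ} = F_α || σγσ⁻¹` for `γ ∈ Γ(N)`. -/
def twistedHecke (N : ℕ) (σ : SL(2, ℤ)) : Submodule ℂ (GL(2, ℚ)⁺ → QM) where
  carrier := {F |
    (∀ γ ∈ CongruenceSubgroup.Gamma N, ∀ α, F (slGL γ * α) = F α) ∧
    ((fun α => (Quotient.mk _ α : CosetGL N)) '' Function.support F).Finite ∧
    ∀ γ ∈ CongruenceSubgroup.Gamma N, ∀ α, F (α * slGL γ) = slashQM (σ * γ * σ⁻¹) (F α)}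
  zero_mem' := ⟨fun _ _ _ => rfl, by simp, fun γ _ α => by simp⟩
  add_mem' := by
    rintro F G ⟨h1, h2, h3⟩ ⟨k1, k2, k3⟩
    refine ⟨fun γ hγ α => ?_, ?_, fun γ hγ α => ?_⟩
    · simp only [Pi.add_apply, h1 γ hγ, k1 γ hγ]
    · refine (h2.union k2).subset ?_
      rw [← Set.image_union]
      exact Set.image_mono (Function.support_add F G)
    · simp only [Pi.add_apply, h3 γ hγ, k3 γ hγ, map_add]
  smul_mem' := by
    rintro c F ⟨h1, h2, h3⟩
    refine ⟨fun γ hγ α => ?_, ?_, fun γ hγ α => ?_⟩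
    · simp only [Pi.smul_apply, h1 γ hγ]
    · exact h2.subset (Set.image_mono (Function.support_const_smul_subset c F))
    · simp only [Pi.smul_apply, h3 γ hγ, map_smul]

/-- A linear map of `QM` into itself that intertwines the operations `|| γ` induces a map between
spaces of twisted Hecke operators. -/
lemma twistedHecke_map {N : ℕ} {σ σ' : SL(2, ℤ)} (L : QM →ₗ[ℂ] QM)
    (hL : ∀ (γ : SL(2, ℤ)) (f : QM), L (slashQM (σ * γ * σ⁻¹) f) =
      slashQM (σ' * γ * σ'⁻¹) (L f))
    {F : GL(2, ℚ)⁺ → QM} (hF : F ∈ twistedHecke N σ) :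
    (fun α => L (F α)) ∈ twistedHecke N σ' := by
  obtain ⟨h1, h2, h3⟩ := hF
  refine ⟨fun γ hγ α => ?_, ?_, fun γ hγ α => ?_⟩
  · simp only [h1 γ hγ]
  · refine h2.subset (Set.image_mono fun α hα => ?_)
    rw [Function.mem_support] at hα ⊢
    intro h
    rw [h, map_zero] at hα
    exact hα rfl
  · simp only [h3 γ hγ, hL]

/-- The operator `X_τ : 𝒬_σ(Γ(N)) → 𝒬_{τσ}(Γ(N))`, `X_τ(F)_α = X(F_α) || τ⁻¹`. -/
def Xtau (N : ℕ) (σ τ σ' : SL(2, ℤ)) (h : σ' = τ * σ) :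
    twistedHecke N σ →ₗ[ℂ] twistedHecke N σ' where
  toFun F := ⟨fun α => slashQM τ⁻¹ (XQM ((F : GL(2, ℚ)⁺ → QM) α)),
    twistedHecke_map (slashQM τ⁻¹ ∘ₗ XQM) (fun γ f => by
      have e : σ * γ * σ⁻¹ * τ⁻¹ = τ⁻¹ * (σ' * γ * σ'⁻¹) := by rw [h]; group
      rw [LinearMap.comp_apply, LinearMap.comp_apply, ← slashQM_XQM, slashQM_slashQM,
        slashQM_slashQM, e]) F.2⟩
  map_add' F G := Subtype.ext (funext fun α => by
    change slashQM τ⁻¹ (XQM ((F : GL(2, ℚ)⁺ → QM) α + (G : GL(2, ℚ)⁺ → QM) α)) = _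
    rw [map_add, map_add]; rfl)
  map_smul' c F := Subtype.ext (funext fun α => by
    change slashQM τ⁻¹ (XQM (c • (F : GL(2, ℚ)⁺ → QM) α)) = _
    rw [map_smul, map_smul]; rfl)

/-- The operator `Y` on `𝒬_σ(Γ(N))`, `Y(F)_α = Y(F_α)`. -/
def Yhecke (N : ℕ) (σ : SL(2, ℤ)) : twistedHecke N σ →ₗ[ℂ] twistedHecke N σ where
  toFun F := ⟨fun α => YQM ((F : GL(2, ℚ)⁺ → QM) α),
    twistedHecke_map YQM (fun γ f => (slashQM_YQM _ f).symm) F.2⟩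
  map_add' F G := Subtype.ext (funext fun α => by simp)
  map_smul' c F := Subtype.ext (funext fun α => by simp)

/-! ### The pairing -/

lemma QM_smul_mul (c : ℂ) (f g : QM) : (c • f) * g = c • (f * g) := by
  induction f using DirectSum.induction_on with
  | zero => simp
  | add f f' hf hf' => rw [smul_add, add_mul, hf, hf', add_mul, smul_add]
  | of k x =>
    induction g using DirectSum.induction_on with
    | zero => simp
    | add f f' hf hf' => rw [mul_add, hf, hf', mul_add, smul_add]
    | of l y =>
      rw [← DirectSum.lof_eq_of ℂ, ← map_smul, DirectSum.lof_eq_of, DirectSum.lof_eq_of,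
        DirectSum.of_mul_of, DirectSum.of_mul_of, ← DirectSum.lof_eq_of ℂ, ← DirectSum.lof_eq_of ℂ,
        ← map_smul]
      congr 1
      exact Subtype.ext (smul_mul_assoc c (x : ℍ → ℂ) (y : ℍ → ℂ))

/-- The summand `(F¹_{βσ} || τ₂⁻¹) · (F²_{ασ⁻¹β⁻¹} || τ₂σβτ₁⁻¹τ₂⁻¹)` of the pairing. -/
def pairTerm (σ τ₁ τ₂ : SL(2, ℤ)) (F₁ F₂ : GL(2, ℚ)⁺ → QM) (α : GL(2, ℚ)⁺) (β : SL(2, ℤ)) : QM :=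
  slashQM τ₂⁻¹ (F₁ (slGL (β * σ))) *
    slashQM (τ₂ * σ * β * τ₁⁻¹ * τ₂⁻¹) (F₂ (α * slGL (σ⁻¹ * β⁻¹)))

lemma pairTerm_mul_left {N : ℕ} {σ τ₁ τ₂ : SL(2, ℤ)} {F₁ F₂ : GL(2, ℚ)⁺ → QM}
    (h₁ : F₁ ∈ twistedHecke N (τ₁ * σ)) (h₂ : F₂ ∈ twistedHecke N (τ₂ * σ)) (α : GL(2, ℚ)⁺)
    {γ : SL(2, ℤ)} (hγ : γ ∈ CongruenceSubgroup.Gamma N) (β : SL(2, ℤ)) :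
    pairTerm σ τ₁ τ₂ F₁ F₂ α (γ * β) = pairTerm σ τ₁ τ₂ F₁ F₂ α β := by
  have e1 : F₁ (slGL (γ * β * σ)) = F₁ (slGL (β * σ)) := by
    rw [mul_assoc, map_mul]; exact h₁.1 γ hγ _
  have e2 : F₂ (α * slGL (σ⁻¹ * (γ * β)⁻¹)) =
      slashQM (τ₂ * σ * γ⁻¹ * (τ₂ * σ)⁻¹) (F₂ (α * slGL (σ⁻¹ * β⁻¹))) := by
    rw [← h₂.2.2 γ⁻¹ (inv_mem hγ), mul_assoc, ← map_mul]
    congr 3; group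
  rw [pairTerm, pairTerm, e1, e2, slashQM_slashQM]
  congr 3; group

lemma pairTerm_eq_of_mk_eq {N : ℕ} {σ τ₁ τ₂ : SL(2, ℤ)} {F₁ F₂ : GL(2, ℚ)⁺ → QM}
    (h₁ : F₁ ∈ twistedHecke N (τ₁ * σ)) (h₂ : F₂ ∈ twistedHecke N (τ₂ * σ)) (α : GL(2, ℚ)⁺)
    {β β' : SL(2, ℤ)} (h : QuotientGroup.rightRel (CongruenceSubgroup.Gamma N) β β') :
    pairTerm σ τ₁ τ₂ F₁ F₂ α β = pairTerm σ τ₁ τ₂ F₁ F₂ α β' := by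
  rw [QuotientGroup.rightRel_apply] at h
  have := pairTerm_mul_left h₁ h₂ α h β
  rw [← this]; congr 1; group

instance finite_cosetSL (N : ℕ) [NeZero N] : Finite (CosetSL N) := by
  have : Finite (SL(2, ℤ) ⧸ CongruenceSubgroup.Gamma N) := inferInstance
  exact Finite.of_equiv _ (QuotientGroup.quotientRightRelEquivQuotientLeftRel _).symm

noncomputable instance fintype_cosetSL (N : ℕ) [NeZero N] : Fintype (CosetSL N) :=
  Fintype.ofFinite _

/-- The pairing of `F₁ ∈ 𝒬_{τ₁σ}(Γ(N))` and `F₂ ∈ 𝒬_{τ₂σ}(Γ(N))`, as a function on `GL(2, ℚ)⁺`: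
the sum of `pairTerm` over `β ∈ Γ(N)\SL(2, ℤ)`. -/
def pairFun (N : ℕ) [NeZero N] (σ τ₁ τ₂ : SL(2, ℤ)) (F₁ : twistedHecke N (τ₁ * σ))
    (F₂ : twistedHecke N (τ₂ * σ)) (α : GL(2, ℚ)⁺) : QM :=
  ∑ q : CosetSL N, Quotient.lift (pairTerm σ τ₁ τ₂ F₁ F₂ α)
    (fun _ _ h => pairTerm_eq_of_mk_eq F₁.2 F₂.2 α h) q

/-- Right translation by `δ`, which normalizes `Γ(N)`, on `Γ(N)\SL(2, ℤ)`. -/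
def cosetShift (N : ℕ) (δ : SL(2, ℤ)) : CosetSL N ≃ CosetSL N where
  toFun := Quotient.map (· * δ) fun a b h => by
    rw [← Quotient.eq_iff_equiv, Quotient.eq, QuotientGroup.rightRel_apply] at h ⊢
    convert h using 1; group
  invFun := Quotient.map (· * δ⁻¹) fun a b h => by
    rw [← Quotient.eq_iff_equiv, Quotient.eq, QuotientGroup.rightRel_apply] at h ⊢
    convert h using 1; group
  left_inv := by
    rintro ⟨a⟩
    change Quotient.mk _ (a * δ * δ⁻¹) = Quotient.mk _ a
    rw [mul_inv_cancel_right]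
  right_inv := by
    rintro ⟨a⟩
    change Quotient.mk _ (a * δ⁻¹ * δ) = Quotient.mk _ a
    rw [inv_mul_cancel_right]

lemma pairFun_mem {N : ℕ} [NeZero N] {σ τ₁ τ₂ : SL(2, ℤ)} (hτ : τ₁ * τ₂ = τ₂ * τ₁)
    (F₁ : twistedHecke N (τ₁ * σ)) (F₂ : twistedHecke N (τ₂ * σ)) :
    pairFun N σ τ₁ τ₂ F₁ F₂ ∈ twistedHecke N (τ₁ * τ₂ * σ) := by
  refine ⟨fun γ hγ α => ?_, ?_, fun γ hγ α => ?_⟩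
  · refine Finset.sum_congr rfl fun q _ => ?_
    induction q using Quotient.inductionOn with
    | h β =>
      simp only [Quotient.lift_mk, pairTerm]
      rw [mul_assoc (slGL γ) α, F₂.2.1 γ hγ]
  · have hfin : (⋃ q : CosetSL N, (fun x : CosetGL N =>
        (Quotient.mk _ (x.out * slGL (q.out * σ)) : CosetGL N)) ''
          ((fun α => (Quotient.mk _ α : CosetGL N)) ''
            Function.support (F₂ : GL(2, ℚ)⁺ → QM))).Finite :=
      Set.finite_iUnion fun q => F₂.2.2.1.image _
    refine hfin.subset ?_
    rintro _ ⟨α, hα, rfl⟩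
    obtain ⟨q, -, hq⟩ := Finset.exists_ne_zero_of_sum_ne_zero hα
    rw [← q.out_eq, Quotient.lift_mk, pairTerm] at hq
    have hne : (F₂ : GL(2, ℚ)⁺ → QM) (α * slGL (σ⁻¹ * q.out⁻¹)) ≠ 0 := by
      intro h
      rw [h, map_zero, mul_zero] at hq
      exact hq rfl
    refine Set.mem_iUnion.2 ⟨q, _, ⟨_, hne, rfl⟩, ?_⟩
    have hx := Quotient.mk_out (s := QuotientGroup.rightRel (GammaGL N))
      (α * slGL (σ⁻¹ * q.out⁻¹))
    rw [QuotientGroup.rightRel_apply] at hx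
    apply Quotient.sound
    rw [← Quotient.eq_iff_equiv, Quotient.eq, QuotientGroup.rightRel_apply]
    convert hx using 1
    simp only [map_mul, map_inv]
    group
  · rw [pairFun, ← Equiv.sum_comp (cosetShift N (σ * γ * σ⁻¹)), pairFun, map_sum]
    refine Finset.sum_congr rfl fun q _ => ?_
    induction q using Quotient.inductionOn with
    | h β =>
      change pairTerm σ τ₁ τ₂ F₁ F₂ (α * slGL γ) (β * (σ * γ * σ⁻¹)) =
        slashQM _ (pairTerm σ τ₁ τ₂ F₁ F₂ α β)
      have e1 : (F₁ : GL(2, ℚ)⁺ → QM) (slGL (β * (σ * γ * σ⁻¹) * σ)) =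
          slashQM (τ₁ * σ * γ * (τ₁ * σ)⁻¹) ((F₁ : GL(2, ℚ)⁺ → QM) (slGL (β * σ))) := by
        rw [← F₁.2.2.2 γ hγ, ← map_mul]
        group
      have e2 : α * slGL γ * slGL (σ⁻¹ * (β * (σ * γ * σ⁻¹))⁻¹) = α * slGL (σ⁻¹ * β⁻¹) := by
        rw [mul_assoc, ← map_mul]
        congr 2; group
      have hτ' : τ₂⁻¹ * τ₁ = τ₁ * τ₂⁻¹ := by
        rw [inv_mul_eq_iff_eq_mul, ← mul_assoc, ← hτ, mul_inv_cancel_right]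
      rw [pairTerm, pairTerm, slashQM_mul, e1, e2]
      simp only [slashQM_slashQM]
      congr 3
      · rw [show τ₂⁻¹ * (τ₁ * τ₂ * σ * γ * (τ₁ * τ₂ * σ)⁻¹) =
          (τ₂⁻¹ * τ₁) * τ₂ * σ * γ * (τ₁ * τ₂ * σ)⁻¹ by group, hτ',
          hτ]
        group
      · rw [hτ]
        group

/-- The pairing `𝒬_{τ₁σ}(Γ(N)) ⊗ 𝒬_{τ₂σ}(Γ(N)) → 𝒬_{τ₁τ₂σ}(Γ(N))` for commuting `τ₁`, `τ₂`. -/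
def pairMap (N : ℕ) [NeZero N] (σ τ₁ τ₂ σ' : SL(2, ℤ)) (hτ : τ₁ * τ₂ = τ₂ * τ₁)
    (h : σ' = τ₁ * τ₂ * σ) :
    twistedHecke N (τ₁ * σ) →ₗ[ℂ] twistedHecke N (τ₂ * σ) →ₗ[ℂ] twistedHecke N σ' :=
  LinearMap.mk₂ ℂ (fun F₁ F₂ => ⟨pairFun N σ τ₁ τ₂ F₁ F₂, h ▸ pairFun_mem hτ F₁ F₂⟩)
    (fun F F' G => Subtype.ext <| funext fun α => by
      simp only [pairFun, Submodule.coe_add, Pi.add_apply, ← Finset.sum_add_distrib]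
      refine Finset.sum_congr rfl fun q _ => ?_
      induction q using Quotient.inductionOn with
      | h β => simp only [Quotient.lift_mk, pairTerm, Pi.add_apply, map_add, add_mul])
    (fun c F G => Subtype.ext <| funext fun α => by
      simp only [pairFun, Submodule.coe_smul, Pi.smul_apply, Finset.smul_sum]
      refine Finset.sum_congr rfl fun q _ => ?_
      induction q using Quotient.inductionOn with
      | h β => simp only [Quotient.lift_mk, pairTerm, Pi.smul_apply, map_smul, QM_smul_mul])
    (fun F G G' => Subtype.ext <| funext fun α => by
      simp only [pairFun, Submodule.coe_add, Pi.add_apply, ← Finset.sum_add_distrib]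
      refine Finset.sum_congr rfl fun q _ => ?_
      induction q using Quotient.inductionOn with
      | h β => simp only [Quotient.lift_mk, pairTerm, Pi.add_apply, map_add, mul_add])
    (fun c F G => Subtype.ext <| funext fun α => by
      simp only [pairFun, Submodule.coe_smul, Pi.smul_apply, Finset.smul_sum]
      refine Finset.sum_congr rfl fun q _ => ?_
      induction q using Quotient.inductionOn with
      | h β =>
        simp only [Quotient.lift_mk, pairTerm, Pi.smul_apply, map_smul]
        rw [mul_comm, QM_smul_mul, mul_comm])

/-! ### The graded module, its operators and its pairing -/

/-- The matrix `ρ_n = (1, n; 0, 1)`. -/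
def rho (n : ℤ) : SL(2, ℤ) := ⟨!![1, n; 0, 1], by simp⟩

lemma rho_add (m n : ℤ) : rho (m + n) = rho m * rho n := by
  apply Subtype.ext
  rw [Matrix.SpecialLinearGroup.coe_mul]
  simp [rho, add_comm]

lemma rho_comm (m n : ℤ) : rho m * rho n = rho n * rho m := by
  rw [← rho_add, ← rho_add, add_comm]

/-- The degree `m` part `𝒬_{σ(m)}(Γ(N))`, `σ(m) = ρ_m σ`, of the graded module. -/
abbrev heckeGr (N : ℕ) (σ : SL(2, ℤ)) (m : ℤ) : Submodule ℂ (GL(2, ℚ)⁺ → QM) :=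
  twistedHecke N (rho m * σ)

/-- The graded module `ℚ_σ(Γ(N)) = ⨁_m 𝒬_{σ(m)}(Γ(N))`. -/
abbrev QQ (N : ℕ) (σ : SL(2, ℤ)) : Type := ⨁ m : ℤ, heckeGr N σ m

/-- The operator `X_n` of degree `n` on `ℚ_σ(Γ(N))`, given by
`X_{ρ_n} : 𝒬_{σ(m)}(Γ(N)) → 𝒬_{σ(m + n)}(Γ(N))`. -/
def Xop (N : ℕ) (σ : SL(2, ℤ)) (n : ℤ) : QQ N σ →ₗ[ℂ] QQ N σ :=
  DirectSum.toModule ℂ ℤ (QQ N σ) fun m =>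
    DirectSum.lof ℂ ℤ (fun m => heckeGr N σ m) (m + n) ∘ₗ
      Xtau N (rho m * σ) (rho n) (rho (m + n) * σ) (by
        rw [add_comm, rho_add, mul_assoc])

/-- The operator `Z` of degree `0` on `ℚ_σ(Γ(N))`: `Z(F)_α = m F_α + Y(F_α)` in degree `m`. -/
def Zop (N : ℕ) (σ : SL(2, ℤ)) : QQ N σ →ₗ[ℂ] QQ N σ :=
  DirectSum.lmap fun m : ℤ => (m : ℂ) • LinearMap.id + Yhecke N (rho m * σ)

/-- The pairing on `ℚ_σ(Γ(N))`, given by the pairings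
`𝒬_{σ(m)}(Γ(N)) ⊗ 𝒬_{σ(n)}(Γ(N)) → 𝒬_{σ(m + n)}(Γ(N))`. -/
def pairing (N : ℕ) [NeZero N] (σ : SL(2, ℤ)) : QQ N σ →ₗ[ℂ] QQ N σ →ₗ[ℂ] QQ N σ :=
  DirectSum.toModule ℂ ℤ (QQ N σ →ₗ[ℂ] QQ N σ) fun m => LinearMap.flip <|
    DirectSum.toModule ℂ ℤ (heckeGr N σ m →ₗ[ℂ] QQ N σ) fun n => LinearMap.flip <|
      (pairMap N σ (rho m) (rho n) (rho (m + n) * σ) (rho_comm m n)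
        (by rw [rho_add])).compr₂ (DirectSum.lof ℂ ℤ (fun m => heckeGr N σ m) (m + n))

/-- On homogeneous elements the pairing is given by `pairFun`. -/
lemma pairing_lof {N : ℕ} [NeZero N] {σ : SL(2, ℤ)} (m n : ℤ) (F : heckeGr N σ m)
    (G : heckeGr N σ n) :
    pairing N σ (DirectSum.lof ℂ ℤ (fun m => heckeGr N σ m) m F)
        (DirectSum.lof ℂ ℤ (fun m => heckeGr N σ m) n G) =
      DirectSum.lof ℂ ℤ (fun m => heckeGr N σ m) (m + n)
        (pairMap N σ (rho m) (rho n) (rho (m + n) * σ) (rho_comm m n) (by rw [rho_add]) F G) := by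
  simp [pairing]


/-! ### The Hopf algebra structure of an enveloping algebra -/

section Enveloping

attribute [local instance] LieRing.ofAssociativeRing

variable (R L : Type*) [CommRing R] [LieRing L] [LieAlgebra R L]

/-- Short name for the enveloping algebra. -/
abbrev Env : Type _ := UniversalEnvelopingAlgebra R L

/-- The coproduct of the enveloping algebra, `Δ(x) = x ⊗ 1 + 1 ⊗ x` for `x` in the Lie algebra. -/
def envComul : Env R L →ₐ[R] Env R L ⊗[R] Env R L :=
  UniversalEnvelopingAlgebra.lift R
    { toFun := fun x => UniversalEnvelopingAlgebra.ι R x ⊗ₜ[R] (1 : Env R L) +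
        (1 : Env R L) ⊗ₜ[R] UniversalEnvelopingAlgebra.ι R x
      map_add' := fun x y => by
        rw [map_add, TensorProduct.add_tmul, TensorProduct.tmul_add]; abel
      map_smul' := fun c x => by
        rw [map_smul, ← TensorProduct.smul_tmul', TensorProduct.tmul_smul, smul_add,
          RingHom.id_apply]
      map_lie' := fun {x y} => by
        simp only [LieHom.map_lie, LieRing.of_associative_ring_bracket, TensorProduct.sub_tmul,
          TensorProduct.tmul_sub, add_mul, mul_add, Algebra.TensorProduct.tmul_mul_tmul, mul_one,
          one_mul]
        abel }

/-- The counit of the enveloping algebra, which vanishes on the Lie algebra. -/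
def envCounit : Env R L →ₐ[R] R := UniversalEnvelopingAlgebra.lift R 0

lemma envComul_ι (x : L) : envComul R L (UniversalEnvelopingAlgebra.ι R x) =
    UniversalEnvelopingAlgebra.ι R x ⊗ₜ[R] (1 : Env R L) +
      (1 : Env R L) ⊗ₜ[R] UniversalEnvelopingAlgebra.ι R x :=
  UniversalEnvelopingAlgebra.lift_ι_apply R _ x

lemma envCounit_ι (x : L) : envCounit R L (UniversalEnvelopingAlgebra.ι R x) = 0 :=
  UniversalEnvelopingAlgebra.lift_ι_apply R _ x

/-- The antipode of the enveloping algebra as an anti-homomorphism, `S(x) = -x` for `x` in the Lie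
algebra. -/
def envAntipode : Env R L →ₐ[R] (Env R L)ᵐᵒᵖ :=
  UniversalEnvelopingAlgebra.lift R
    { toFun := fun x => MulOpposite.op (-UniversalEnvelopingAlgebra.ι R x)
      map_add' := fun x y => by
        rw [map_add, ← MulOpposite.op_add, neg_add]
      map_smul' := fun c x => by
        rw [map_smul, ← smul_neg, MulOpposite.op_smul, RingHom.id_apply]
      map_lie' := fun {x y} => by
        simp only [LieHom.map_lie, LieRing.of_associative_ring_bracket, ← MulOpposite.op_mul,
          ← MulOpposite.op_sub, neg_mul_neg, neg_sub] }

lemma env_hom_ext {A : Type*} [Ring A] [Algebra R A] {f g : Env R L →ₐ[R] A}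
    (h : ∀ x, f (UniversalEnvelopingAlgebra.ι R x) = g (UniversalEnvelopingAlgebra.ι R x)) :
    f = g := by
  apply UniversalEnvelopingAlgebra.hom_ext
  ext x
  exact h x

instance envBialgebra : Bialgebra R (Env R L) :=
  .ofAlgHom (envComul R L) (envCounit R L)
    (env_hom_ext R L fun x => by
      simp [-UniversalEnvelopingAlgebra.ι_apply, envComul_ι, Algebra.TensorProduct.one_def,
        TensorProduct.add_tmul, TensorProduct.tmul_add]
      abel)
    (env_hom_ext R L fun x => by
      simp [-UniversalEnvelopingAlgebra.ι_apply, envComul_ι, envCounit_ι])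
    (env_hom_ext R L fun x => by
      simp [-UniversalEnvelopingAlgebra.ι_apply, envComul_ι, envCounit_ι])

lemma env_induction {p : Env R L → Prop} (hι : ∀ x, p (UniversalEnvelopingAlgebra.ι R x))
    (hr : ∀ r, p (algebraMap R (Env R L) r)) (hadd : ∀ a b, p a → p b → p (a + b))
    (hmul : ∀ a b, p a → p b → p (a * b)) (a : Env R L) : p a := by
  let S : Subalgebra R (Env R L) :=
    { carrier := {a | p a}
      mul_mem' := fun {a b} ha hb => hmul a b ha hb
      add_mem' := fun {a b} ha hb => hadd a b ha hb
      algebraMap_mem' := hr }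
  let f : Env R L →ₐ[R] S := UniversalEnvelopingAlgebra.lift R
    { toFun := fun x => ⟨UniversalEnvelopingAlgebra.ι R x, hι x⟩
      map_add' := fun x y => Subtype.ext (map_add _ x y)
      map_smul' := fun c x => Subtype.ext (map_smul _ c x)
      map_lie' := fun {x y} => Subtype.ext (LieHom.map_lie _ x y) }
  have hf : S.val.comp f = AlgHom.id R (Env R L) := env_hom_ext R L fun x => by
    have := UniversalEnvelopingAlgebra.lift_ι_apply R
      ({ toFun := fun x => ⟨UniversalEnvelopingAlgebra.ι R x, hι x⟩
         map_add' := fun x y => Subtype.ext (map_add _ x y)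
         map_smul' := fun c x => Subtype.ext (map_smul _ c x)
         map_lie' := fun {x y} => Subtype.ext (LieHom.map_lie _ x y) } : L →ₗ⁅R⁆ S) x
    exact congrArg Subtype.val this
  have := AlgHom.congr_fun hf a
  rw [AlgHom.comp_apply, AlgHom.id_apply] at this
  rw [← this]
  exact (f a).2

/-- The antipode as a linear map. -/
def envS : Env R L →ₗ[R] Env R L :=
  (MulOpposite.opLinearEquiv R).symm.toLinearMap ∘ₗ (envAntipode R L).toLinearMap

lemma envS_mul (a b : Env R L) : envS R L (a * b) = envS R L b * envS R L a := by
  simp [envS]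

lemma envS_algebraMap (r : R) : envS R L (algebraMap R (Env R L) r) = algebraMap R (Env R L) r := by
  simp [envS]

lemma envS_one : envS R L 1 = 1 := by
  simp [envS]

lemma envS_ι (x : L) : envS R L (UniversalEnvelopingAlgebra.ι R x) =
    -UniversalEnvelopingAlgebra.ι R x := by
  change MulOpposite.unop (envAntipode R L _) = _
  rw [envAntipode, UniversalEnvelopingAlgebra.lift_ι_apply]
  rfl

instance envHopfAlgebra : HopfAlgebra R (Env R L) where
  antipode := envS R L
  mul_antipode_rTensor_comul := by
    set φ : Env R L ⊗[R] Env R L →ₗ[R] Env R L := LinearMap.mul' R (Env R L) ∘ₗ (envS R L).rTensor (Env R L) with hφ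
    have h1 : ∀ (t : Env R L ⊗[R] Env R L) (b c : Env R L), φ (t * b ⊗ₜ c) = envS R L b * φ t * c := by
      intro t b c
      induction t with
      | zero => simp
      | add x y hx hy => rw [add_mul, map_add, hx, hy, map_add, mul_add, add_mul]
      | tmul x y => simp [hφ, envS_mul, mul_assoc]
    have h2 : ∀ (t u : Env R L ⊗[R] Env R L) (r : R), φ t = algebraMap R (Env R L) r → φ (t * u) = r • φ u := by
      intro t u r ht
      induction u with
      | zero => simp
      | add x y hx hy => rw [mul_add, map_add, hx, hy, map_add, smul_add]
      | tmul x y =>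
        rw [h1, ht, ← Algebra.commutes, mul_assoc, ← Algebra.smul_def]
        simp [hφ]
    ext a
    change φ (envComul R L a) = algebraMap R (Env R L) (envCounit R L a)
    induction a using env_induction R L with
    | hι x => 
      simp [-UniversalEnvelopingAlgebra.ι_apply, hφ, envComul_ι, envCounit_ι, envS_ι, envS_one]
    | hr r => simp [hφ, envS_algebraMap]
    | hadd a b ha hb => simp only [map_add, ha, hb]
    | hmul a b ha hb =>
      rw [map_mul, h2 _ _ _ ha, hb, map_mul, map_mul, Algebra.smul_def]
  mul_antipode_lTensor_comul := by
    set φ : Env R L ⊗[R] Env R L →ₗ[R] Env R L := LinearMap.mul' R (Env R L) ∘ₗ (envS R L).lTensor (Env R L) with hφ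
    have h1 : ∀ (t : Env R L ⊗[R] Env R L) (b c : Env R L), φ (b ⊗ₜ c * t) = b * φ t * envS R L c := by
      intro t b c
      induction t with
      | zero => simp
      | add x y hx hy => rw [mul_add, map_add, hx, hy, map_add, mul_add, add_mul]
      | tmul x y => simp [hφ, envS_mul, mul_assoc]
    have h2 : ∀ (t u : Env R L ⊗[R] Env R L) (r : R), φ u = algebraMap R (Env R L) r → φ (t * u) = r • φ t := by
      intro t u r hu
      induction t with
      | zero => simp
      | add x y hx hy => rw [add_mul, map_add, hx, hy, map_add, smul_add]
      | tmul x y =>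
        rw [h1, hu, ← Algebra.commutes, mul_assoc, ← Algebra.smul_def]
        simp [hφ]
    ext a
    change φ (envComul R L a) = algebraMap R (Env R L) (envCounit R L a)
    induction a using env_induction R L with
    | hι x => 
      simp [-UniversalEnvelopingAlgebra.ι_apply, hφ, envComul_ι, envCounit_ι, envS_ι, envS_one]
    | hr r => simp [hφ, envS_one]
    | hadd a b ha hb => simp only [map_add, ha, hb]
    | hmul a b ha hb =>
      rw [map_mul, h2 _ _ _ hb, ha, map_mul, mul_comm, map_mul, Algebra.smul_def]

end Enveloping
/-! ### The Lie algebra and its enveloping algebra -/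

/-- The generators `Z` and `X_n`, `n ∈ ℤ`. -/
inductive LieGen : Type
  | Z : LieGen
  | X : ℤ → LieGen

/-- The relators `[Z, X_n] - (n + 1) X_n` and `[X_n, X_{n'}]`. -/
def lieRel : Set (FreeLieAlgebra ℂ LieGen) :=
  (Set.range fun n : ℤ => ⁅FreeLieAlgebra.of ℂ LieGen.Z, FreeLieAlgebra.of ℂ (LieGen.X n)⁆ -
    ((n : ℂ) + 1) • FreeLieAlgebra.of ℂ (LieGen.X n)) ∪
  Set.range fun p : ℤ × ℤ =>
    ⁅FreeLieAlgebra.of ℂ (LieGen.X p.1), FreeLieAlgebra.of ℂ (LieGen.X p.2)⁆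

/-- The Lie algebra `𝔩_ℤ` with generators `Z`, `X_n` and relations `[Z, X_n] = (n + 1) X_n`,
`[X_n, X_{n'}] = 0`. -/
abbrev lZ : Type := FreeLieAlgebra ℂ LieGen ⧸
  LieSubmodule.lieSpan ℂ (FreeLieAlgebra ℂ LieGen) lieRel

/-- The image of a generator in `𝔩_ℤ`. -/
def lgen (g : LieGen) : lZ := LieSubmodule.Quotient.mk (FreeLieAlgebra.of ℂ g)

/-- The enveloping algebra `𝔥_ℤ` of `𝔩_ℤ`. -/
abbrev hZ : Type := UniversalEnvelopingAlgebra ℂ lZ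

/-- The image of a generator in `𝔥_ℤ`. -/
def hgen (g : LieGen) : hZ := UniversalEnvelopingAlgebra.ι ℂ (lgen g)

/-- The generators of `𝔥_ℤ` are primitive. -/
lemma comul_hgen (g : LieGen) : Coalgebra.comul (R := ℂ) (hgen g) =
    hgen g ⊗ₜ[ℂ] (1 : hZ) + (1 : hZ) ⊗ₜ[ℂ] hgen g :=
  envComul_ι ℂ lZ (lgen g)

/-- For an action of `𝔥_ℤ` on `ℚ_σ(Γ(N))`, the linear map
`𝔥_ℤ ⊗ 𝔥_ℤ → ℚ_σ(Γ(N))`, `a ⊗ b ↦ (a(F₁), b(F₂))`. -/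
def pairAct (N : ℕ) [NeZero N] (σ : SL(2, ℤ)) (act : hZ →ₐ[ℂ] Module.End ℂ (QQ N σ))
    (F₁ F₂ : QQ N σ) : hZ ⊗[ℂ] hZ →ₗ[ℂ] QQ N σ :=
  TensorProduct.lift ((pairing N σ).compl₁₂
    (LinearMap.applyₗ F₁ ∘ₗ act.toLinearMap) (LinearMap.applyₗ F₂ ∘ₗ act.toLinearMap))

lemma pairAct_tmul {N : ℕ} [NeZero N] {σ : SL(2, ℤ)} (act : hZ →ₐ[ℂ] Module.End ℂ (QQ N σ))
    (F₁ F₂ : QQ N σ) (a b : hZ) :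
    pairAct N σ act F₁ F₂ (a ⊗ₜ[ℂ] b) = pairing N σ (act a F₁) (act b F₂) := rfl

end QuasiHecke

end

noncomputable section

namespace QuasiHecke

/-! ### Derivation property of the operators on the quasimodular tower -/

/-! A Hopf action of an enveloping algebra on a pairing is the same thing as an action of the Lie
algebra by derivations of the pairing. The coproduct is multiplicative and the elements of the Lie
algebra are primitive, so the Hopf identity is the Leibniz rule on the Lie algebra, is clear on
scalars, and passes to sums and products (`act_mul_pairing`, `act_pairing`). Derivations of a
bilinear map form a Lie algebra under the commutator, so the Leibniz rule is needed only for the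
generators. Two things remain: the operators `X_n` and `Z` satisfy the defining relations of `𝔩_ℤ`
(`Xop_comm`, `Zop_Xop`), and they are derivations of the pairing (`Xop_pairing`, `Zop_pairing`).

Both come from three facts about the quasimodular tower: `X` and `Y` are derivations (`XQM_mul`,
`YQM_mul`), they commute with the operations `|| γ`, and `[Y, X] = X` (`YQM_XQM`). Since `X` and `Y`
act only on the coefficients `a_i(f)`, the series `G₂` behaves as a constant. The facts thus reduce
to the Leibniz rule of the Ramanujan (Serre) derivative, which raises the weight by two, and to the
additivity of weights.

On twisted Hecke operators, the relation `[Z, X_n] = (n + 1) X_n` collects `n` from the shift of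
degree and `1` from `[Y, X] = X`. For the pairing, each summand is a product of two twisted values.
Applying a derivation gives two products, and these are the summands of the two pairings on the
right for the same `β`. For `X_n` the twists have to agree as well, and they do because the matrices
`ρ_m` commute and `ρ_m ρ_n = ρ_{m+n}`. -/

/-- A product of elements `a G₂ ^ i` and `b G₂ ^ j` is again of this form. -/
lemma exists_gen_mul (k l i j : ℕ) (a : modTower ((k : ℤ) - 2 * (i : ℤ)))
    (b : modTower ((l : ℤ) - 2 * (j : ℤ))) :
    ∃ c : modTower (((k + l : ℕ) : ℤ) - 2 * ((i + j : ℕ) : ℤ)),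
      (c : ℍ → ℂ) = (a : ℍ → ℂ) * b ∧ gen k i a * gen l j b = gen (k + l) (i + j) c := by
  have hw : ((k : ℤ) - 2 * (i : ℤ)) + ((l : ℤ) - 2 * (j : ℤ)) =
    ((k + l : ℕ) : ℤ) - 2 * ((i + j : ℕ) : ℤ) := by push_cast; ring
  have hm : (a : ℍ → ℂ) * b ∈ modTower (((k + l : ℕ) : ℤ) - 2 * ((i + j : ℕ) : ℤ)) :=
    hw ▸ modTower_mul a.2 b.2
  exact ⟨⟨_, hm⟩, rfl, gen_mul k l i j a b _ rfl⟩

lemma gen_add (k i : ℕ) (a b : modTower ((k : ℤ) - 2 * (i : ℤ))) :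
    gen k i (a + b) = gen k i a + gen k i b := by
  simp only [gen, map_add]

lemma gen_smul (k i : ℕ) (c : ℂ) (a : modTower ((k : ℤ) - 2 * (i : ℤ))) :
    gen k i (c • a) = c • gen k i a := by
  simp only [gen, map_smul]

/-- Transport between weights that are equal only propositionally. Recording that the underlying
function is unchanged lets the two terms of a Leibniz rule be added in one weight without casts. -/
lemma exists_gen_eq {k l : ℕ} (h : k = l) (i : ℕ) (a : modTower ((k : ℤ) - 2 * (i : ℤ))) :
    ∃ b : modTower ((l : ℤ) - 2 * (i : ℤ)), (b : ℍ → ℂ) = a ∧ gen k i a = gen l i b := by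
  subst h
  exact ⟨a, rfl, rfl⟩

/-- Since `(log Δ)' = 2πi E₂`, the correction subtracted from the derivative is `(w / 12) E₂ f`. It
is linear in the weight, and weights add under products, so the Leibniz rule of `d/dz` survives. -/
lemma ramanujan_mul {v w : ℤ} {f g : ℍ → ℂ} (hf : MDiff f) (hg : MDiff g) :
    ramanujan (v + w) (f * g) = ramanujan v f * g + f * ramanujan w g := by
  rw [ramanujan_eq, ramanujan_eq, ramanujan_eq]
  push_cast
  rw [Derivative.serreDerivative_mul _ _ _ _ hf hg]

/-- `X` is a derivation of the quasimodular tower. -/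
lemma XQM_mul (f g : QM) : XQM (f * g) = XQM f * g + f * XQM g := by
  induction f using QM_induction with
  | h0 => simp
  | hadd f f' hf hf' => simp only [add_mul, map_add, hf, hf']; abel
  | hgen k i a =>
    induction g using QM_induction with
    | h0 => simp
    | hadd f f' hf hf' => simp only [mul_add, map_add, hf, hf']; abel
    | hgen l j b =>
      obtain ⟨c, hc, e⟩ := exists_gen_mul k l i j a b
      rw [e, XQM_gen, XQM_gen, XQM_gen]
      obtain ⟨c₁, hc₁, e₁⟩ := exists_gen_mul (k + 2) l i j (modX _ _ (by push_cast; ring) a) b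
      obtain ⟨c₂, hc₂, e₂⟩ := exists_gen_mul k (l + 2) i j a (modX _ _ (by push_cast; ring) b)
      -- The products `X(a) b` and `a X(b)` come in weights `(k + 2) + l` and `k + (l + 2)`; both
      -- are moved to the weight `(k + l) + 2` of `X(ab)`. The power of `G₂` is `i + j` in all
      -- three, so only the modular coefficients are left to compare.
      obtain ⟨d₁, hd₁, e₁'⟩ := exists_gen_eq (add_right_comm k 2 l) (i + j) c₁
      obtain ⟨d₂, hd₂, e₂'⟩ := exists_gen_eq (add_assoc k l 2).symm (i + j) c₂
      rw [e₁, e₂, e₁', e₂', ← gen_add]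
      congr 1
      apply Subtype.ext
      change ramanujan _ (c : ℍ → ℂ) = (d₁ : ℍ → ℂ) + d₂
      rw [hc, hd₁, hd₂, hc₁, hc₂]
      change _ = ramanujan _ (a : ℍ → ℂ) * (b : ℍ → ℂ) + a * ramanujan _ (b : ℍ → ℂ)
      rw [← ramanujan_mul (modTower_holo a.2) (modTower_holo b.2)]
      -- What is left is the equality of weights `(k + l) - 2 (i + j) = (k - 2 i) + (l - 2 j)`.
      congr 1
      push_cast
      ring

/-- `Y` is diagonal on the elements `a G₂ ^ i`. The eigenvalue is half the weight of `a` alone, not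
of the product, and it is additive in `(k, i)`. This turns the derivation property of `Y` and its
commutation with `X` into arithmetic of eigenvalues. -/
lemma YQM_gen_eq_smul (k i : ℕ) (a : modTower ((k : ℤ) - 2 * (i : ℤ))) :
    YQM (gen k i a) = ((k : ℂ) / 2 - i) • gen k i a := by
  rw [YQM_gen, ← gen_smul]
  congr 1
  rw [modY, LinearMap.smul_apply, LinearMap.id_apply]
  congr 1
  push_cast
  ring

/-- `Y` is a derivation of the quasimodular tower. -/
lemma YQM_mul (f g : QM) : YQM (f * g) = YQM f * g + f * YQM g := by
  induction f using QM_induction with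
  | h0 => simp
  | hadd f f' hf hf' => simp only [add_mul, map_add, hf, hf']; abel
  | hgen k i a =>
    induction g using QM_induction with
    | h0 => simp
    | hadd f f' hf hf' => simp only [mul_add, map_add, hf, hf']; abel
    | hgen l j b =>
      obtain ⟨c, -, e⟩ := exists_gen_mul k l i j a b
      rw [YQM_gen_eq_smul, YQM_gen_eq_smul, QM_smul_mul, mul_comm _ (_ • _), QM_smul_mul,
        mul_comm (gen l j b), ← add_smul, e, YQM_gen_eq_smul]
      congr 1
      push_cast
      ring

/-- The commutation relation `[Y, X] = X` on the quasimodular tower. -/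
lemma YQM_XQM (f : QM) : YQM (XQM f) = XQM (YQM f) + XQM f := by
  induction f using QM_induction with
  | h0 => simp
  | hadd f f' hf hf' => simp only [map_add, hf, hf']; abel
  | hgen k i a =>
    -- `X` replaces `k` by `k + 2` and keeps `i`, so the eigenvalue of `Y` rises by exactly one.
    rw [YQM_gen_eq_smul, XQM_gen, YQM_gen_eq_smul, map_smul, XQM_gen]
    nth_rw 3 [← one_smul ℂ (gen _ _ _)]
    rw [← add_smul]
    congr 1
    push_cast
    ring

/-! ### The operators `X_n` and `Z` -/

lemma rho_inv_mul (m n : ℤ) : (rho m)⁻¹ * (rho n)⁻¹ = (rho (m + n))⁻¹ := by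
  rw [← mul_inv_rev, ← rho_add, add_comm]

/-- Elements of different homogeneous components of `ℚ_σ(Γ(N))` with the same values agree. -/
lemma lof_congr {N : ℕ} {σ : SL(2, ℤ)} {m n : ℤ} (h : m = n) (F : heckeGr N σ m)
    (G : heckeGr N σ n) (hFG : (F : GL(2, ℚ)⁺ → QM) = G) :
    DirectSum.lof ℂ ℤ (fun m => heckeGr N σ m) m F =
      DirectSum.lof ℂ ℤ (fun m => heckeGr N σ m) n G := by
  subst h
  rw [Subtype.ext hFG]

/-- The analogue of `exists_gen_eq` for the degree: it brings the terms of an identity in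
`ℚ_σ(Γ(N))`, whose degrees are associated differently, into one homogeneous component. -/
lemma exists_lof_eq {N : ℕ} {σ : SL(2, ℤ)} {m n : ℤ} (h : m = n) (F : heckeGr N σ m) :
    ∃ G : heckeGr N σ n, (G : GL(2, ℚ)⁺ → QM) = F ∧
      DirectSum.lof ℂ ℤ (fun m => heckeGr N σ m) m F =
        DirectSum.lof ℂ ℤ (fun m => heckeGr N σ m) n G := by
  subst h
  exact ⟨F, rfl, rfl⟩

lemma Xop_lof {N : ℕ} {σ : SL(2, ℤ)} (n m : ℤ) (F : heckeGr N σ m) :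
    Xop N σ n (DirectSum.lof ℂ ℤ (fun m => heckeGr N σ m) m F) =
      DirectSum.lof ℂ ℤ (fun m => heckeGr N σ m) (m + n)
        (Xtau N (rho m * σ) (rho n) (rho (m + n) * σ)
          (by rw [add_comm, rho_add, mul_assoc]) F) := by
  rw [Xop, DirectSum.toModule_lof, LinearMap.comp_apply]

lemma Zop_lof {N : ℕ} {σ : SL(2, ℤ)} (m : ℤ) (F : heckeGr N σ m) :
    Zop N σ (DirectSum.lof ℂ ℤ (fun m => heckeGr N σ m) m F) =
      DirectSum.lof ℂ ℤ (fun m => heckeGr N σ m) m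
        ((m : ℂ) • F + Yhecke N (rho m * σ) F) := by
  rw [Zop, DirectSum.lmap_lof]
  rfl

/-- Slashing commutes with `X`, so either composite applies `X` twice and then slashes by
`ρ_{n+n'}⁻¹`. -/
lemma Xop_comm (N : ℕ) (σ : SL(2, ℤ)) (n n' : ℤ) :
    Xop N σ n * Xop N σ n' = Xop N σ n' * Xop N σ n := by
  apply DirectSum.linearMap_ext
  intro m
  ext1 F
  simp only [LinearMap.comp_apply, Module.End.mul_apply, Xop_lof]
  refine lof_congr (by ring) _ _ (funext fun α => ?_)
  change slashQM (rho n)⁻¹ (XQM (slashQM (rho n')⁻¹ (XQM ((F : GL(2, ℚ)⁺ → QM) α)))) =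
    slashQM (rho n')⁻¹ (XQM (slashQM (rho n)⁻¹ (XQM ((F : GL(2, ℚ)⁺ → QM) α))))
  rw [← slashQM_XQM, ← slashQM_XQM, slashQM_slashQM, slashQM_slashQM, rho_inv_mul, rho_inv_mul,
    add_comm]

/-- In degree `m` the two composites differ by the scalars `m + n` and `m` of `Z` in the target and
source degrees, which contributes `n`, and by `[Y, X] = X`, which contributes `1`. -/
lemma Zop_Xop (N : ℕ) (σ : SL(2, ℤ)) (n : ℤ) :
    Zop N σ * Xop N σ n = Xop N σ n * Zop N σ + ((n : ℂ) + 1) • Xop N σ n := by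
  apply DirectSum.linearMap_ext
  intro m
  ext1 F
  simp only [LinearMap.comp_apply, LinearMap.add_apply, LinearMap.smul_apply,
    Module.End.mul_apply, Xop_lof, Zop_lof]
  rw [← LinearMap.map_smul (DirectSum.lof ℂ ℤ (fun m => heckeGr N σ m) (m + n)), ← map_add]
  refine lof_congr rfl _ _ (funext fun α => ?_)
  change ((m + n : ℤ) : ℂ) • slashQM (rho n)⁻¹ (XQM ((F : GL(2, ℚ)⁺ → QM) α)) +
      YQM (slashQM (rho n)⁻¹ (XQM ((F : GL(2, ℚ)⁺ → QM) α))) =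
      slashQM (rho n)⁻¹ (XQM ((m : ℂ) • (F : GL(2, ℚ)⁺ → QM) α +
        YQM ((F : GL(2, ℚ)⁺ → QM) α))) +
    ((n : ℂ) + 1) • slashQM (rho n)⁻¹ (XQM ((F : GL(2, ℚ)⁺ → QM) α))
  rw [← slashQM_YQM, YQM_XQM]
  simp only [map_add, map_smul]
  push_cast
  module

/-! ### The operators and the pairing -/

/-- To compare pairings it suffices to compare the summands. -/
lemma pairFun_eq_add {N : ℕ} [NeZero N] {σ τ₁ τ₂ τ₃ τ₄ τ₅ τ₆ : SL(2, ℤ)}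
    {F₁ : twistedHecke N (τ₁ * σ)} {F₂ : twistedHecke N (τ₂ * σ)}
    {F₃ : twistedHecke N (τ₃ * σ)} {F₄ : twistedHecke N (τ₄ * σ)}
    {F₅ : twistedHecke N (τ₅ * σ)} {F₆ : twistedHecke N (τ₆ * σ)}
    (L : QM →ₗ[ℂ] QM) (α : GL(2, ℚ)⁺)
    (h : ∀ β, L (pairTerm σ τ₁ τ₂ F₁ F₂ α β) =
      pairTerm σ τ₃ τ₄ F₃ F₄ α β + pairTerm σ τ₅ τ₆ F₅ F₆ α β) :
    L (pairFun N σ τ₁ τ₂ F₁ F₂ α) =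
      pairFun N σ τ₃ τ₄ F₃ F₄ α + pairFun N σ τ₅ τ₆ F₅ F₆ α := by
  rw [pairFun, pairFun, pairFun, map_sum, ← Finset.sum_add_distrib]
  refine Finset.sum_congr rfl fun q _ => ?_
  induction q using Quotient.inductionOn with
  | h β => exact h β

/-- In each summand `X` obeys the Leibniz rule, and the outer slash by `ρ_k⁻¹` distributes over the
product. The twists of the pairing depend on the degrees of both arguments, so raising one degree by
`k` also alters the twist of the other factor. These changes account exactly for the outer slash. -/
lemma Xop_pairing (N : ℕ) [NeZero N] (σ : SL(2, ℤ)) (k : ℤ) (F₁ F₂ : QQ N σ) :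
    Xop N σ k (pairing N σ F₁ F₂) =
      pairing N σ (Xop N σ k F₁) F₂ + pairing N σ F₁ (Xop N σ k F₂) := by
  induction F₁ using DirectSum.induction_on with
  | zero => simp
  | add F F' hF hF' => simp only [map_add, LinearMap.add_apply, hF, hF']; abel
  | of m F =>
    induction F₂ using DirectSum.induction_on with
    | zero => simp
    | add G G' hG hG' => simp only [map_add, hG, hG']; abel
    | of n G =>
      simp only [← DirectSum.lof_eq_of ℂ]
      rw [pairing_lof, Xop_lof, Xop_lof, Xop_lof, pairing_lof, pairing_lof]
      -- The terms on the right have degrees `m + k + n` and `m + (n + k)`, the left side `m + n +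
      -- k`.
      obtain ⟨P, hP, eP⟩ := exists_lof_eq (add_right_comm m k n) (pairMap N σ (rho (m + k))
        (rho n) (rho (m + k + n) * σ) (rho_comm _ _) (by rw [rho_add (m + k)])
        (Xtau N (rho m * σ) (rho k) (rho (m + k) * σ)
          (by rw [add_comm, rho_add, mul_assoc]) F) G)
      obtain ⟨Q, hQ, eQ⟩ := exists_lof_eq (add_assoc m n k).symm (pairMap N σ (rho m)
        (rho (n + k)) (rho (m + (n + k)) * σ) (rho_comm _ _) (by rw [rho_add m]) F
        (Xtau N (rho n * σ) (rho k) (rho (n + k) * σ)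
          (by rw [add_comm, rho_add, mul_assoc]) G))
      rw [eP, eQ, ← map_add]
      congr 1
      refine Subtype.ext (funext fun α => ?_)
      rw [Submodule.coe_add, hP, hQ]
      refine pairFun_eq_add (N := N) (slashQM (rho k)⁻¹ ∘ₗ XQM) α fun β => ?_
      simp only [pairTerm, LinearMap.comp_apply, XQM_mul, map_add, slashQM_mul, slashQM_slashQM,
        ← slashQM_XQM]
      change slashQM _ (XQM _) * _ + _ * slashQM _ (XQM _) =
        slashQM (rho n)⁻¹ (slashQM (rho k)⁻¹ (XQM _)) * _ +
          _ * slashQM _ (slashQM (rho k)⁻¹ (XQM _))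
      -- The twists of the second factor: `h₂` serves the term where `X_k` hits `F` and `G` only
      -- feels the degree `m + k`. In `h₃`, where `X_k` hits `G`, its own `ρ_k⁻¹` turns the leading
      -- `ρ_{n+k}` back into `ρ_n`. The first factor needs only `h₁`.
      have h₁ : (rho n)⁻¹ * (rho k)⁻¹ = (rho k)⁻¹ * (rho n)⁻¹ := by
        rw [rho_inv_mul, rho_inv_mul, add_comm]
      have h₂ : rho n * σ * β * (rho m)⁻¹ * (rho n)⁻¹ * (rho k)⁻¹ =
          rho n * σ * β * (rho (m + k))⁻¹ * (rho n)⁻¹ := by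
        rw [← rho_inv_mul]
        simp only [mul_assoc, h₁]
      have h₃ : rho n * σ * β * (rho m)⁻¹ * (rho n)⁻¹ * (rho k)⁻¹ =
          (rho k)⁻¹ * (rho (n + k) * σ * β * (rho m)⁻¹ * (rho (n + k))⁻¹) := by
        rw [← rho_inv_mul, add_comm, rho_add]
        group
      rw [slashQM_slashQM, slashQM_slashQM, ← h₂, ← h₃, h₁, ← rho_inv_mul n k, h₁]

/-- The scalar part of `Z` obeys the Leibniz rule because the pairing adds degrees, and the `Y` part
because `Y` is a derivation commuting with every slash. No twist changes, as `Z` has degree zero. -/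
lemma Zop_pairing (N : ℕ) [NeZero N] (σ : SL(2, ℤ)) (F₁ F₂ : QQ N σ) :
    Zop N σ (pairing N σ F₁ F₂) =
      pairing N σ (Zop N σ F₁) F₂ + pairing N σ F₁ (Zop N σ F₂) := by
  induction F₁ using DirectSum.induction_on with
  | zero => simp
  | add F F' hF hF' => simp only [map_add, LinearMap.add_apply, hF, hF']; abel
  | of m F =>
    induction F₂ using DirectSum.induction_on with
    | zero => simp
    | add G G' hG hG' => simp only [map_add, hG, hG']; abel
    | of n G =>
      simp only [← DirectSum.lof_eq_of ℂ]
      rw [pairing_lof, Zop_lof, Zop_lof, Zop_lof, pairing_lof, pairing_lof, ← map_add]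
      congr 1
      refine Subtype.ext (funext fun α => ?_)
      refine pairFun_eq_add (N := N) (((m + n : ℤ) : ℂ) • LinearMap.id + YQM) α fun β => ?_
      simp only [pairTerm, LinearMap.add_apply, LinearMap.smul_apply, LinearMap.id_apply, YQM_mul,
        ← slashQM_YQM]
      change _ = slashQM _ ((m : ℂ) • (F : GL(2, ℚ)⁺ → QM) _ + YQM _) * _ +
        _ * slashQM _ ((n : ℂ) • (G : GL(2, ℚ)⁺ → QM) _ + YQM _)
      simp only [map_add, map_smul, add_mul, mul_add, QM_smul_mul]
      rw [mul_comm _ ((n : ℂ) • _), QM_smul_mul, mul_comm _ (slashQM (rho n)⁻¹ _)]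
      push_cast
      module

/-! ### Derivations of a bilinear map and Hopf actions -/

attribute [local instance] LieRing.ofAssociativeRing

/-- The Lie algebra of derivations of a bilinear map `V × V → V`. -/
def bilinDerivations {V : Type*} [AddCommGroup V] [Module ℂ V] (B : V →ₗ[ℂ] V →ₗ[ℂ] V) :
    LieSubalgebra ℂ (Module.End ℂ V) where
  carrier := {D | ∀ x y, D (B x y) = B (D x) y + B x (D y)}
  add_mem' := fun {D E} hD hE x y => by
    simp only [LinearMap.add_apply, map_add, hD x y, hE x y]; abel
  zero_mem' := fun x y => by simp
  smul_mem' := fun c D hD x y => by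
    simp only [LinearMap.smul_apply, map_smul, hD x y, smul_add]
  lie_mem' := fun {D E} hD hE x y => by
    have hD : ∀ x y, D (B x y) = B (D x) y + B x (D y) := hD
    have hE : ∀ x y, E (B x y) = B (E x) y + B x (E y) := hE
    -- The mixed terms `B (D x) (E y)` and `B (E x) (D y)` occur in both `D E` and `E D` and cancel
    -- in the commutator.
    simp only [LieRing.of_associative_ring_bracket, LinearMap.sub_apply, Module.End.mul_apply,
      map_sub, map_add, hD, hE]
    abel

/-- A Lie algebra morphism that kills an ideal factors through the quotient. -/
def lieQuotientLift {L M : Type*} [LieRing L] [LieAlgebra ℂ L] [LieRing M] [LieAlgebra ℂ M]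
    (I : LieIdeal ℂ L) (f : L →ₗ⁅ℂ⁆ M) (h : I ≤ f.ker) : L ⧸ I →ₗ⁅ℂ⁆ M :=
  { I.toSubmodule.liftQ (f : L →ₗ[ℂ] M) (fun x hx => LieHom.mem_ker.1 (h hx)) with
    map_lie' := fun {x y} => by
      obtain ⟨x, rfl⟩ := LieSubmodule.Quotient.surjective_mk' I x
      obtain ⟨y, rfl⟩ := LieSubmodule.Quotient.surjective_mk' I y
      exact f.map_lie x y }

section Action

variable {V : Type*} [AddCommGroup V] [Module ℂ V] {B : V →ₗ[ℂ] V →ₗ[ℂ] V}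

/-- Derivations satisfying the relations of `𝔩_ℤ` define an action of `𝔩_ℤ` by derivations. -/
def lieAction (D : LieGen → bilinDerivations B)
    (hZX : ∀ n : ℤ, ⁅D LieGen.Z, D (LieGen.X n)⁆ = ((n : ℂ) + 1) • D (LieGen.X n))
    (hXX : ∀ n n' : ℤ, ⁅D (LieGen.X n), D (LieGen.X n')⁆ = 0) : lZ →ₗ⁅ℂ⁆ bilinDerivations B :=
  lieQuotientLift _ (FreeLieAlgebra.lift ℂ D) <| by
    rw [LieSubmodule.lieSpan_le]
    rintro _ (⟨n, rfl⟩ | ⟨⟨n, n'⟩, rfl⟩)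
    · rw [SetLike.mem_coe, LieHom.mem_ker, map_sub, map_smul, LieHom.map_lie,
        FreeLieAlgebra.lift_of_apply, FreeLieAlgebra.lift_of_apply, hZX, sub_self]
    · rw [SetLike.mem_coe, LieHom.mem_ker, LieHom.map_lie, FreeLieAlgebra.lift_of_apply,
        FreeLieAlgebra.lift_of_apply, hXX]

lemma lieAction_lgen (D : LieGen → bilinDerivations B) (hZX) (hXX) (g : LieGen) :
    lieAction D hZX hXX (lgen g) = D g :=
  FreeLieAlgebra.lift_of_apply D g

/-- Derivations of a bilinear map satisfying the relations of `𝔩_ℤ` define an action of `𝔥_ℤ` in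
which `𝔩_ℤ` acts by derivations. -/
lemma exists_action (Z : Module.End ℂ V) (X : ℤ → Module.End ℂ V)
    (hZX : ∀ n : ℤ, Z * X n = X n * Z + ((n : ℂ) + 1) • X n)
    (hXX : ∀ n n' : ℤ, X n * X n' = X n' * X n)
    (dZ : ∀ x y, Z (B x y) = B (Z x) y + B x (Z y))
    (dX : ∀ n x y, X n (B x y) = B (X n x) y + B x (X n y)) :
    ∃ act : hZ →ₐ[ℂ] Module.End ℂ V, (∀ n, act (hgen (LieGen.X n)) = X n) ∧
      act (hgen LieGen.Z) = Z ∧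
      ∀ a x y, act (UniversalEnvelopingAlgebra.ι ℂ a) (B x y) =
        B (act (UniversalEnvelopingAlgebra.ι ℂ a) x) y +
          B x (act (UniversalEnvelopingAlgebra.ι ℂ a) y) := by
  -- With the Lie algebra of derivations as target, the universal property makes every element of
  -- `𝔩_ℤ` a derivation, with no induction on brackets. Only afterwards are derivations included in
  -- all endomorphisms and extended to `𝔥_ℤ`.
  let D : LieGen → bilinDerivations B
    | LieGen.Z => ⟨Z, dZ⟩
    | LieGen.X n => ⟨X n, dX n⟩
  let f := lieAction D (fun n => Subtype.ext (sub_eq_iff_eq_add'.2 (hZX n)))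
    (fun n n' => Subtype.ext (sub_eq_zero.2 (hXX n n')))
  have hact : ∀ a, UniversalEnvelopingAlgebra.lift ℂ ((bilinDerivations B).incl.comp f)
      (UniversalEnvelopingAlgebra.ι ℂ a) = (f a : Module.End ℂ V) :=
    UniversalEnvelopingAlgebra.lift_ι_apply ℂ _
  refine ⟨UniversalEnvelopingAlgebra.lift ℂ ((bilinDerivations B).incl.comp f), fun n => ?_, ?_,
    fun a => ?_⟩
  · rw [hgen, hact, lieAction_lgen]
  · rw [hgen, hact, lieAction_lgen]
  · rw [hact]
    exact (f a).2

end Action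

/-- A version of `exists_action` for a vector space without chosen negation. -/
lemma exists_action_of_addCommMonoid {V : Type*} [i₁ : AddCommMonoid V] [i₂ : Module ℂ V]
    {B : V →ₗ[ℂ] V →ₗ[ℂ] V} (Z : Module.End ℂ V) (X : ℤ → Module.End ℂ V)
    (hZX : ∀ n : ℤ, Z * X n = X n * Z + ((n : ℂ) + 1) • X n)
    (hXX : ∀ n n' : ℤ, X n * X n' = X n' * X n)
    (dZ : ∀ x y, Z (B x y) = B (Z x) y + B x (Z y))
    (dX : ∀ n x y, X n (B x y) = B (X n x) y + B x (X n y)) :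
    ∃ act : hZ →ₐ[ℂ] Module.End ℂ V, (∀ n, act (hgen (LieGen.X n)) = X n) ∧
      act (hgen LieGen.Z) = Z ∧
      ∀ a x y, act (UniversalEnvelopingAlgebra.ι ℂ a) (B x y) =
        B (act (UniversalEnvelopingAlgebra.ι ℂ a) x) y +
          B x (act (UniversalEnvelopingAlgebra.ι ℂ a) y) :=
  -- Negation is supplied as multiplication by `-1`. The addition is the given one, so endomorphisms
  -- and conclusion are unchanged.
  @exists_action V (Module.addCommMonoidToAddCommGroup ℂ) i₂ B Z X hZX hXX dZ dX

/-! ### From primitive elements to the whole enveloping algebra -/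

lemma algHom_end_mul_apply {A V : Type*} [Semiring A] [Algebra ℂ A] [AddCommMonoid V] [Module ℂ V]
    (act : A →ₐ[ℂ] Module.End ℂ V) (a b : A) (v : V) : act (a * b) v = act a (act b v) := by
  rw [map_mul, Module.End.mul_apply]

/-- Products in `𝔥_ℤ ⊗ 𝔥_ℤ` act by composition in each argument, so the right factor may be absorbed
into `F₁` and `F₂`. -/
lemma pairAct_mul_tmul {N : ℕ} [NeZero N] {σ : SL(2, ℤ)} (act : hZ →ₐ[ℂ] Module.End ℂ (QQ N σ))
    (F₁ F₂ : QQ N σ) (t : hZ ⊗[ℂ] hZ) (a b : hZ) :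
    pairAct N σ act F₁ F₂ (t * a ⊗ₜ[ℂ] b) = pairAct N σ act (act a F₁) (act b F₂) t := by
  induction t with
  | zero => simp
  | add t u ht hu => rw [add_mul, map_add, ht, hu, map_add]
  | tmul c d =>
    rw [Algebra.TensorProduct.tmul_mul_tmul, pairAct_tmul, pairAct_tmul, algHom_end_mul_apply,
      algHom_end_mul_apply]

/-- The Hopf identity is multiplicative: `b` is distributed first, then `a` on each resulting
pairing, and `Δ(ab) = Δ(a) Δ(b)` reassembles the sum. The identity for `a` is applied at the moved
arguments `b₍₁₎(F₁)`, `b₍₂₎(F₂)`, hence the quantified hypotheses. -/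
lemma act_mul_pairing {N : ℕ} [NeZero N] {σ : SL(2, ℤ)} (act : hZ →ₐ[ℂ] Module.End ℂ (QQ N σ))
    {a b : hZ}
    (ha : ∀ F₁ F₂, act a (pairing N σ F₁ F₂) =
      pairAct N σ act F₁ F₂ (Coalgebra.comul (R := ℂ) a))
    (hb : ∀ F₁ F₂, act b (pairing N σ F₁ F₂) =
      pairAct N σ act F₁ F₂ (Coalgebra.comul (R := ℂ) b)) (F₁ F₂ : QQ N σ) :
    act (a * b) (pairing N σ F₁ F₂) =
      pairAct N σ act F₁ F₂ (Coalgebra.comul (R := ℂ) (a * b)) := by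
  rw [algHom_end_mul_apply, hb, Bialgebra.comul_mul]
  -- Both sides are linear in `Δ(b)`, which can therefore be replaced by an arbitrary tensor and
  -- then by a pure one.
  induction Coalgebra.comul (R := ℂ) b with
  | zero => simp
  | add t u ht hu => rw [map_add, map_add, ht, hu, mul_add, map_add]
  | tmul c d => rw [pairAct_tmul, ha, pairAct_mul_tmul]

/-- An action of `𝔥_ℤ` in which the Lie algebra acts by derivations of the pairing is a Hopf
action. -/
lemma act_pairing {N : ℕ} [NeZero N] {σ : SL(2, ℤ)} (act : hZ →ₐ[ℂ] Module.End ℂ (QQ N σ))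
    (hact : ∀ x F₁ F₂, act (UniversalEnvelopingAlgebra.ι ℂ x) (pairing N σ F₁ F₂) =
      pairing N σ (act (UniversalEnvelopingAlgebra.ι ℂ x) F₁) F₂ +
        pairing N σ F₁ (act (UniversalEnvelopingAlgebra.ι ℂ x) F₂)) (h : hZ) (F₁ F₂ : QQ N σ) :
    act h (pairing N σ F₁ F₂) = pairAct N σ act F₁ F₂ (Coalgebra.comul (R := ℂ) h) := by
  induction h using env_induction ℂ lZ generalizing F₁ F₂ with
  | hι x =>
    change _ = pairAct N σ act F₁ F₂ (envComul ℂ lZ (UniversalEnvelopingAlgebra.ι ℂ x))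
    rw [envComul_ι, map_add, pairAct_tmul, pairAct_tmul, map_one]
    exact hact x F₁ F₂
  | hr r =>
    -- A scalar has coproduct `r ⊗ 1`, so it acts on the first argument alone.
    rw [Bialgebra.comul_algebraMap, AlgHom.commutes, Algebra.TensorProduct.algebraMap_apply,
      pairAct_tmul, AlgHom.commutes, map_one]
    simp [Module.algebraMap_end_apply]
  | hadd a b ha hb => rw [map_add, map_add, map_add, LinearMap.add_apply, ha, hb]
  | hmul a b ha hb =>
    exact act_mul_pairing act ha hb F₁ F₂

end QuasiHecke

end

theorem mainTheorem3 (N : ℕ) [NeZero N] (σ : SL(2, ℤ)) :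
    ∃ act : QuasiHecke.hZ →ₐ[ℂ] Module.End ℂ (QuasiHecke.QQ N σ),
      (∀ n : ℤ, act (QuasiHecke.hgen (QuasiHecke.LieGen.X n)) = QuasiHecke.Xop N σ n) ∧
      act (QuasiHecke.hgen QuasiHecke.LieGen.Z) = QuasiHecke.Zop N σ ∧
      (∀ (h : QuasiHecke.hZ) (F₁ F₂ : QuasiHecke.QQ N σ),
        act h (QuasiHecke.pairing N σ F₁ F₂) =
          QuasiHecke.pairAct N σ act F₁ F₂ (Coalgebra.comul (R := ℂ) h)) ∧
      (∀ (n : ℤ) (F₁ F₂ : QuasiHecke.QQ N σ),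
        QuasiHecke.Xop N σ n (QuasiHecke.pairing N σ F₁ F₂) =
          QuasiHecke.pairing N σ (QuasiHecke.Xop N σ n F₁) F₂ +
            QuasiHecke.pairing N σ F₁ (QuasiHecke.Xop N σ n F₂)) ∧
      ∀ F₁ F₂ : QuasiHecke.QQ N σ,
        QuasiHecke.Zop N σ (QuasiHecke.pairing N σ F₁ F₂) =
          QuasiHecke.pairing N σ (QuasiHecke.Zop N σ F₁) F₂ +
            QuasiHecke.pairing N σ F₁ (QuasiHecke.Zop N σ F₂) := by
  obtain ⟨act, hX, hZ, hact⟩ := QuasiHecke.exists_action_of_addCommMonoid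
    (QuasiHecke.Zop N σ) (QuasiHecke.Xop N σ) (QuasiHecke.Zop_Xop N σ) (QuasiHecke.Xop_comm N σ)
    (QuasiHecke.Zop_pairing N σ) (QuasiHecke.Xop_pairing N σ)
  -- The two Leibniz rules at the end are the inputs of the construction, so they are not rederived
  -- from the Hopf identity.
  exact ⟨act, hX, hZ, QuasiHecke.act_pairing act hact, QuasiHecke.Xop_pairing N σ,
    QuasiHecke.Zop_pairing N σ⟩
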